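/- Let $N\ge 1$ and let $\mathcal H=L^2(\mathbb R^N)$ be the Hilbert space of $N$ bosonic modes with phase space $\mathbb R^{2N}$, whose points are written ${\bf x}=(q_1,p_1,\ldots,q_N,p_N)^T$. Let $W({\bf x})$ be the Weyl operators, $(W({\bf x})\psi)(t)=e^{i(p\cdot t-\frac12 p\cdot q)}\psi(t-q)$, where $q=(q_1,\ldots,q_N)$ and $p=(p_1,\ldots,p_N)$. A state is a positive operator $\rho$ on $\mathcal H$ with $\mathrm{tr}[\rho]=1$; for a state (or trace class operator) $\rho$ its Weyl transform is $\widehat\rho({\bf x})=\mathrm{tr}[\rho W({\bf x})]$. An observable on $\mathbb R^M$ is a map $\mathsf E$ from the Borel sets of $\mathbb R^M$ to the positive bounded operators on $\mathcal H$ with $\mathsf E(\mathbb R^M)=I$ that is $\sigma$-additive in the weak operator topology; its characteristic function is $\widehat{\mathsf E}({\bf p})=\int e^{i{\bf p}^T{\bf x}}\,\mathsf E(d{\bf x})$ (a weak integral). A family $\{\mathsf E_j\mid j\in\mathcal I\}$ of observables is informationally complete if any two states $\rho_1,\rho_2$ with $\mathrm{tr}[\rho_1\mathsf E_j(X)]=\mathrm{tr}[\rho_2\mathsf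 E_j(X)]$ for all $j$ and all Borel sets $X$ are equal. (1) Let $\mathsf E_j$, $j\in\mathcal I$, be observables on $\mathbb R^{M_j}$ such that $\widehat{\mathsf E_j}({\bf p})=W({\bf A}_0^j{\bf p})f_0^j({\bf p})$ for all ${\bf p}\in\mathbb R^{M_j}$, where ${\bf A}_0^j$ is a real $2N\times M_j$ matrix and $f_0^j:\mathbb R^{M_j}\to\mathbb C$ is a function. Put $Y_{\mathsf E_j}=\{{\bf A}_0^j{\bf p}\mid {\bf p}\in\mathbb R^{M_j},\ f_0^j({\bf p})\ne 0\}$. Then $\{\mathsf E_j\mid j\in\mathcal I\}$ is informationally complete if and only if $\bigcup_{j\in\mathcal I}Y_{\mathsf E_j}$ is dense in $\mathbb R^{2N}$. (2) For every state $\sigma$ the formula $$\mathsf E_\sigma(X)=\frac1{(2\pi)^N}\int_X W({\bf x})\,\sigma\, W({\bf x})^*\,d{\bf x}$$ (a weak integral) defines an observable on $\mathbb R^{2N}$, which is covariant, i.e. $W({\bf x})\mathsf E_\sigma(X)W({\bf x})^*=\mathsf E_\sigma(X+{\bf x})$ for all ${\bf x}\in\mathbb R^{2N}$ and all Borel sets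 $X$. The single observable $\mathsf E_\sigma$ is informationally complete if and only if $\widehat\sigma$ has full support, i.e. the closure of $\{{\bf x}\mid\widehat\sigma({\bf x})\ne0\}$ is $\mathbb R^{2N}$. -/

import Mathlib

open MeasureTheory
open scoped InnerProductSpace

noncomputable section

/-- Configuration space `ℝ^N` of `N` modes. -/
abbrev ConfigSpace (N : ℕ) : Type := EuclideanSpace ℝ (Fin N)

/-- Phase space `ℝ^{2N}`; the coordinate `(j, 0)` is `q_j` and the coordinate `(j, 1)` is `p_j`. -/
abbrev PhaseSpace (N : ℕ) : Type := EuclideanSpace ℝ (Fin N × Fin 2)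

/-- The Hilbert space `L²(ℝ^N)` of the `N`-mode field in the coordinate representation. -/
abbrev ModeSpace (N : ℕ) : Type := Lp ℂ 2 (volume : Measure (ConfigSpace N))

/-- The position part `q` of a phase space point. -/
def phasePos {N : ℕ} (x : PhaseSpace N) : ConfigSpace N := WithLp.toLp 2 fun j => x (j, 0)

/-- The momentum part `p` of a phase space point. -/
def phaseMom {N : ℕ} (x : PhaseSpace N) : ConfigSpace N := WithLp.toLp 2 fun j => x (j, 1)

/-- The phase factor `t ↦ e^{i (p·t - p·q / 2)}`. -/
def weylPhase {N : ℕ} (x : PhaseSpace N) (t : ConfigSpace N) : ℂ :=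
  Complex.exp (Complex.I * ((⟪phaseMom x, t⟫_ℝ - ⟪phaseMom x, phasePos x⟫_ℝ / 2 : ℝ) : ℂ))

theorem norm_weylPhase {N : ℕ} (x : PhaseSpace N) (t : ConfigSpace N) : ‖weylPhase x t‖ = 1 := by
  rw [weylPhase, mul_comm, Complex.norm_exp_ofReal_mul_I]

theorem continuous_weylPhase {N : ℕ} (x : PhaseSpace N) : Continuous (weylPhase x) := by
  unfold weylPhase
  fun_prop

theorem memLp_weylPhase_mul {N : ℕ} (x : PhaseSpace N) (ψ : ModeSpace N) :
    MemLp (fun t => weylPhase x t * ψ t) 2 (volume : Measure (ConfigSpace N)) :=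
  (Lp.memLp ψ).congr_norm
    ((continuous_weylPhase x).aestronglyMeasurable.mul (Lp.aestronglyMeasurable ψ))
    (Filter.Eventually.of_forall fun t => by simp [norm_weylPhase])

/-- Multiplication by the phase factor, as an isometry of `L²(ℝ^N)`. -/
def weylMul {N : ℕ} (x : PhaseSpace N) : ModeSpace N →ₗᵢ[ℂ] ModeSpace N where
  toFun ψ := (memLp_weylPhase_mul x ψ).toLp _
  map_add' ψ φ := by
    apply Lp.ext
    filter_upwards [(memLp_weylPhase_mul x (ψ + φ)).coeFn_toLp,
      (memLp_weylPhase_mul x ψ).coeFn_toLp, (memLp_weylPhase_mul x φ).coeFn_toLp,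
      Lp.coeFn_add ψ φ,
      Lp.coeFn_add ((memLp_weylPhase_mul x ψ).toLp _) ((memLp_weylPhase_mul x φ).toLp _)]
      with t h1 h2 h3 h4 h5
    rw [h1, h5, Pi.add_apply, h2, h3, h4, Pi.add_apply, mul_add]
  map_smul' c ψ := by
    apply Lp.ext
    filter_upwards [(memLp_weylPhase_mul x (c • ψ)).coeFn_toLp,
      (memLp_weylPhase_mul x ψ).coeFn_toLp, Lp.coeFn_smul c ψ,
      Lp.coeFn_smul c ((memLp_weylPhase_mul x ψ).toLp _)] with t h1 h2 h3 h4
    rw [h1, RingHom.id_apply, h4, Pi.smul_apply, h2, h3, Pi.smul_apply, smul_eq_mul, smul_eq_mul]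
    ring
  norm_map' ψ := by
    apply le_antisymm
    · refine Lp.norm_le_norm_of_ae_le ?_
      filter_upwards [(memLp_weylPhase_mul x ψ).coeFn_toLp] with t h
      simp only [LinearMap.coe_mk, AddHom.coe_mk]
      rw [h, norm_mul, norm_weylPhase, one_mul]
    · refine Lp.norm_le_norm_of_ae_le ?_
      filter_upwards [(memLp_weylPhase_mul x ψ).coeFn_toLp] with t h
      simp only [LinearMap.coe_mk, AddHom.coe_mk]
      rw [h, norm_mul, norm_weylPhase, one_mul]

/-- Translation `ψ ↦ ψ(· - q)`, as an isometry of `L²(ℝ^N)`. -/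
def weylShift {N : ℕ} (x : PhaseSpace N) : ModeSpace N →ₗᵢ[ℂ] ModeSpace N :=
  Lp.compMeasurePreservingₗᵢ ℂ (fun t => t - phasePos x)
    (measurePreserving_sub_right volume (phasePos x))

/-- The Weyl operator `W(x) = e^{-i xᵀ Ω R} = e^{i (p·Q - q·P)}`, which acts on `L²(ℝ^N)` by
`(W(x) ψ)(t) = e^{i (p·t - p·q / 2)} ψ(t - q)` for `x = (q₁, p₁, …, q_N, p_N)`. -/
def weyl {N : ℕ} (x : PhaseSpace N) : ModeSpace N →L[ℂ] ModeSpace N :=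
  ((weylMul x).comp (weylShift x)).toContinuousLinearMap

theorem weyl_apply_ae {N : ℕ} (x : PhaseSpace N) (ψ : ModeSpace N) :
    weyl x ψ =ᵐ[volume] fun t => Complex.exp (Complex.I *
      ((⟪phaseMom x, t⟫_ℝ - ⟪phaseMom x, phasePos x⟫_ℝ / 2 : ℝ) : ℂ)) * ψ (t - phasePos x) := by
  have h1 := (memLp_weylPhase_mul x (weylShift x ψ)).coeFn_toLp
  have h2 := Lp.coeFn_compMeasurePreserving ψ
    (measurePreserving_sub_right (volume : Measure (ConfigSpace N)) (phasePos x))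
  filter_upwards [h1, h2] with t h1 h2
  exact h1.trans (congrArg (weylPhase x t * ·) h2)

section Trace

variable {H : Type*} [NormedAddCommGroup H] [InnerProductSpace ℂ H] [CompleteSpace H]

/-- The trace `tr T = ∑ᵢ ⟪eᵢ, T eᵢ⟫` over an orthonormal (Hilbert) basis. The sum does not depend
on the basis if `T` is trace class or positive, and it is `0` by convention if the family is not
summable. -/
def opTrace (T : H →L[ℂ] H) : ℂ :=
  ∑' e : (exists_hilbertBasis ℂ H).choose, ⟪(e : H), T e⟫_ℂ

/-- States are the positive operators of trace one; `tr ρ = 1` includes that the sum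
defining the trace converges, so that `ρ` is trace class. -/
structure IsState (ρ : H →L[ℂ] H) : Prop where
  isPositive : ρ.IsPositive
  trace_eq_one : opTrace ρ = 1

end Trace

/-- The Weyl transform `ρ̂(x) = tr (ρ W(x))`. -/
def weylTransform {N : ℕ} (ρ : ModeSpace N →L[ℂ] ModeSpace N) (x : PhaseSpace N) : ℂ :=
  opTrace (ρ * weyl x)

/-- Observables: positive operator valued measures on the outcome space `α`, normalized, and
`σ`-additive in the weak operator topology. Only the values on measurable sets matter. -/
structure Observable (N : ℕ) (α : Type*) [MeasurableSpace α] where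
  eff : Set α → (ModeSpace N →L[ℂ] ModeSpace N)
  isPositive : ∀ X, MeasurableSet X → (eff X).IsPositive
  eff_univ : eff Set.univ = 1
  hasSum_iUnion : ∀ X : ℕ → Set α, (∀ i, MeasurableSet (X i)) →
    Pairwise (Function.onFun Disjoint X) → ∀ φ ψ : ModeSpace N,
      HasSum (fun i => ⟪φ, eff (X i) ψ⟫_ℂ) ⟪φ, eff (⋃ i, X i) ψ⟫_ℂ

namespace Observable

variable {N : ℕ} {α : Type*} [MeasurableSpace α]

theorem hasSum_re (E : Observable N α) (ψ : ModeSpace N) (X : ℕ → Set α)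
    (hX : ∀ i, MeasurableSet (X i)) (hd : Pairwise (Function.onFun Disjoint X)) :
    HasSum (fun i => (⟪ψ, E.eff (X i) ψ⟫_ℂ).re) (⟪ψ, E.eff (⋃ i, X i) ψ⟫_ℂ).re :=
  Complex.hasSum_re (E.hasSum_iUnion X hX hd ψ ψ)

/-- The measure `X ↦ ⟪ψ, E(X) ψ⟫`. -/
def diagMeasure (E : Observable N α) (ψ : ModeSpace N) : Measure α :=
  Measure.ofMeasurable (fun X _ => ENNReal.ofReal (⟪ψ, E.eff X ψ⟫_ℂ).re)
    (by
      have h := E.hasSum_re ψ (fun _ => ∅) (fun _ => MeasurableSet.empty)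
        (fun _ _ _ => disjoint_bot_left)
      have h0 := (summable_const_iff _).1 h.summable
      simp [h0])
    (by
      intro X hX hd
      have h := E.hasSum_re ψ X hX hd
      rw [← h.tsum_eq]
      exact ENNReal.ofReal_tsum_of_nonneg
        (fun i => (E.isPositive (X i) (hX i)).re_inner_nonneg_right ψ) h.summable)

theorem diagMeasure_apply (E : Observable N α) (ψ : ModeSpace N) {X : Set α}
    (hX : MeasurableSet X) :
    E.diagMeasure ψ X = ENNReal.ofReal (⟪ψ, E.eff X ψ⟫_ℂ).re :=
  Measure.ofMeasurable_apply X hX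

/-- `T` is the value `Ê(p) = ∫ e^{i pᵀ x} E(dx)` of the characteristic function of `E` at `p`.
The operator integral is understood weakly, and by polarization a bounded operator on a
complex Hilbert space is determined by its quadratic form. -/
def HasCharFunAt {M : ℕ} (E : Observable N (EuclideanSpace ℝ (Fin M)))
    (p : EuclideanSpace ℝ (Fin M)) (T : ModeSpace N →L[ℂ] ModeSpace N) : Prop :=
  ∀ ψ : ModeSpace N, ⟪ψ, T ψ⟫_ℂ = charFun (E.diagMeasure ψ) p

/-- `E` has characteristic function `Ê(p) = W(A₀ p) f₀(p)`. -/
def IsLinearBosonic {M : ℕ} (E : Observable N (EuclideanSpace ℝ (Fin M)))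
    (A₀ : Matrix (Fin N × Fin 2) (Fin M) ℝ) (f₀ : EuclideanSpace ℝ (Fin M) → ℂ) : Prop :=
  ∀ p, E.HasCharFunAt p (f₀ p • weyl (A₀.toEuclideanLin p))

/-- Covariance under phase space translations: `W(x) E(X) W(x)* = E(X + x)`. -/
def IsCovariant (E : Observable N (PhaseSpace N)) : Prop :=
  ∀ (x : PhaseSpace N) (X : Set (PhaseSpace N)), MeasurableSet X →
    weyl x * E.eff X * ContinuousLinearMap.adjoint (weyl x) = E.eff ((fun y => y + x) '' X)

/-- `E = E_σ`, that is, `E(X) = (2π)^{-N} ∫_X W(x) σ W(x)* dx`, a weak integral. -/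
def IsGeneratedBy (E : Observable N (PhaseSpace N)) (σ : ModeSpace N →L[ℂ] ModeSpace N) : Prop :=
  ∀ X : Set (PhaseSpace N), MeasurableSet X → ∀ φ ψ : ModeSpace N,
    IntegrableOn (fun x : PhaseSpace N =>
      ⟪φ, (weyl x * σ * ContinuousLinearMap.adjoint (weyl x)) ψ⟫_ℂ) X volume ∧
    ⟪φ, E.eff X ψ⟫_ℂ = (((2 * Real.pi) ^ N : ℝ) : ℂ)⁻¹ *
      ∫ x in X, ⟪φ, (weyl x * σ * ContinuousLinearMap.adjoint (weyl x)) ψ⟫_ℂ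

end Observable

/-- The set `Y = {A₀ p | f₀(p) ≠ 0}`. -/
def reachedSet {N M : ℕ} (A₀ : Matrix (Fin N × Fin 2) (Fin M) ℝ)
    (f₀ : EuclideanSpace ℝ (Fin M) → ℂ) : Set (PhaseSpace N) :=
  {y | ∃ p, f₀ p ≠ 0 ∧ A₀.toEuclideanLin p = y}

/-- A family of observables is informationally complete if states with the same outcome
distributions `X ↦ tr (ρ E_j(X))` for all `j` are equal. -/
def InformationallyComplete {N : ℕ} {I : Type*} {α : I → Type*} [∀ j, MeasurableSpace (α j)]
    (E : (j : I) → Observable N (α j)) : Prop :=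
  ∀ ρ₁ ρ₂ : ModeSpace N →L[ℂ] ModeSpace N, IsState ρ₁ → IsState ρ₂ →
    (∀ j, ∀ X, MeasurableSet X →
      opTrace (ρ₁ * (E j).eff X) = opTrace (ρ₂ * (E j).eff X)) → ρ₁ = ρ₂

end

/-! A state is seen by an observable only through its outcome distribution, a finite measure, and
hence only through the characteristic function of that measure. If `Ê(p) = W(A p) f(p)`, this
function is `f(p) ρ̂(A p)`. Two states are therefore indistinguishable exactly when their Weyl
transforms agree on the union `Y` of the reached sets (`Observable.forall_opTrace_eff_eq_iff`).

If `Y` is dense, continuity of `ρ̂` makes the transforms agree everywhere, and `ρ̂` determines `ρ`.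
The latter comes from the inversion formula, which rests on the orthogonality relations of the Weyl
operators, that is, on Plancherel's theorem in the momentum variable followed by Tonelli.

If `Y` is not dense, two distinct states are constructed that agree on it. Mixing the displaced
vectors `W(z) g` over a probability measure `μ` multiplies the Weyl transform of the pure state of
`g` by the characteristic function of `μ`, up to the symplectic rotation `J`
(`weylTransform_weylMixture`). It suffices to take two measures whose characteristic functions
differ at `J u`, with `u` outside the closure of `Y`, but only near `± J u`, and a vector `g` with
`⟪g, W(u) g⟫ ≠ 0`. Since `Y = -Y`, the resulting states agree on `Y` and differ at `u`.

For `E_σ`, the orthogonality relations give integrability of the kernel and the normalization, while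
`√σ` gives positivity. Its characteristic function is `σ̂(J t) W(-J t)`, so the same criterion
applies, and the reached set is the reflection of `{σ̂ ≠ 0}`.

Traces are handled by writing a state as `∑ |vᵢ⟩⟨vᵢ|` with `vᵢ = √ρ eᵢ`, which reduces statements
about states to absolutely convergent sums over vectors. -/

noncomputable section

/-! ### Traces of states and their decomposition into vectors. -/

section TraceClass

variable {H : Type*} [NormedAddCommGroup H] [InnerProductSpace ℂ H]

theorem inner_self_eq_ofReal_norm_sq (x : H) : ⟪x, x⟫_ℂ = ((‖x‖ ^ 2 : ℝ) : ℂ) := by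
  rw [inner_self_eq_norm_sq_to_K]
  norm_cast

/-- An orthonormal family in a separable space is countable. -/
theorem Orthonormal.countable_of_separableSpace [TopologicalSpace.SeparableSpace H] {ι : Type*}
    {v : ι → H} (hv : Orthonormal ℂ v) : Countable ι := by
  have hd : Pairwise fun i j => 1 ≤ dist (v i) (v j) := by
    intro i j hij
    have h : ‖v i - v j‖ ^ 2 = 2 := by
      rw [@norm_sub_sq ℂ, hv.2 hij, hv.1 i, hv.1 j]
      norm_num
    rw [dist_eq_norm]
    nlinarith [norm_nonneg (v i - v j)]
  have hdisj : Pairwise (Function.onFun Disjoint fun i => Metric.ball (v i) (1 / 2)) := by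
    intro i j hij
    exact Metric.ball_disjoint_ball (by linarith [hd hij])
  exact Pairwise.countable_of_isOpen_disjoint hdisj (fun i => Metric.isOpen_ball)
    (fun i => ⟨v i, Metric.mem_ball_self (by norm_num)⟩)

theorem norm_inner_apply_self_le {ι : Type*} (v : ι → H) (B : H →L[ℂ] H) (i : ι) :
    ‖⟪v i, B (v i)⟫_ℂ‖ ≤ ‖B‖ * ‖v i‖ ^ 2 :=
  calc ‖⟪v i, B (v i)⟫_ℂ‖ ≤ ‖v i‖ * ‖B (v i)‖ := norm_inner_le_norm _ _
    _ ≤ ‖v i‖ * (‖B‖ * ‖v i‖) := by gcongr; exact B.le_opNorm _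
    _ = _ := by ring

theorem HilbertBasis.hasSum_sq_norm_inner {ι : Type*} (b : HilbertBasis ι ℂ H) (x : H) :
    HasSum (fun i => ‖⟪b i, x⟫_ℂ‖ ^ 2) (‖x‖ ^ 2) := by
  have h := Complex.hasSum_re (b.hasSum_inner_mul_inner x x)
  rw [inner_self_eq_ofReal_norm_sq, Complex.ofReal_re] at h
  convert h using 2 with i
  rw [← inner_conj_symm x, ← Complex.normSq_eq_conj_mul_self, Complex.ofReal_re,
    Complex.normSq_eq_norm_sq]

variable [CompleteSpace H]

/-- The Hilbert basis used in the definition of `opTrace`. -/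
def traceBasis (H : Type*) [NormedAddCommGroup H] [InnerProductSpace ℂ H] [CompleteSpace H] :
    HilbertBasis (exists_hilbertBasis ℂ H).choose ℂ H :=
  (exists_hilbertBasis ℂ H).choose_spec.choose

theorem traceBasis_apply (e : (exists_hilbertBasis ℂ H).choose) : traceBasis H e = (e : H) :=
  congrFun (exists_hilbertBasis ℂ H).choose_spec.choose_spec e

theorem opTrace_eq_tsum_traceBasis (T : H →L[ℂ] H) :
    opTrace T = ∑' e, ⟪traceBasis H e, T (traceBasis H e)⟫_ℂ := by
  simp only [opTrace, traceBasis_apply]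

/-- The trace of `S S B` for a self-adjoint Hilbert-Schmidt operator `S` is that of `S B S`. -/
theorem HilbertBasis.tsum_inner_comp_cyclic {ι : Type*} (b : HilbertBasis ι ℂ H)
    {S : H →L[ℂ] H} (hS : ∀ x y, ⟪S x, y⟫_ℂ = ⟪x, S y⟫_ℂ)
    (hsum : Summable fun i => ‖S (b i)‖ ^ 2) (B : H →L[ℂ] H) :
    ∑' i, ⟪b i, S (S (B (b i)))⟫_ℂ = ∑' i, ⟪S (b i), B (S (b i))⟫_ℂ := by
  -- Summing this double array over `j` gives the left side and over `i` the right side, by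
  -- Parseval. It is absolutely summable because `S` and `B* S` are both Hilbert-Schmidt.
  let F : ι → ι → ℂ := fun i j => ⟪S (b i), b j⟫_ℂ * ⟪b j, S (B (b i))⟫_ℂ
  have hF1 : ∀ i, HasSum (F i) ⟪b i, S (S (B (b i)))⟫_ℂ := fun i => by
    rw [← hS]
    exact b.hasSum_inner_mul_inner _ _
  have hadj : ∀ i j, ⟪b j, S (B (b i))⟫_ℂ =
      ⟪ContinuousLinearMap.adjoint B (S (b j)), b i⟫_ℂ := fun i j => by
    rw [← hS, ContinuousLinearMap.adjoint_inner_left]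
  have hF2 : ∀ j, HasSum (fun i => F i j) ⟪S (b j), B (S (b j))⟫_ℂ := fun j => by
    rw [← ContinuousLinearMap.adjoint_inner_left]
    have h := b.hasSum_inner_mul_inner (ContinuousLinearMap.adjoint B (S (b j))) (S (b j))
    have heq : (fun i => F i j) = fun i =>
        ⟪ContinuousLinearMap.adjoint B (S (b j)), b i⟫_ℂ * ⟪b i, S (b j)⟫_ℂ := by
      ext i
      rw [← hS, ← hadj, mul_comm]
    rwa [heq]
  have hG : Summable fun p : ι × ι => ‖⟪b p.2, S (b p.1)⟫_ℂ‖ ^ 2 := by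
    refine (summable_prod_of_nonneg fun p => sq_nonneg _).2 ⟨fun i =>
      (b.hasSum_sq_norm_inner (S (b i))).summable, ?_⟩
    simpa only [(b.hasSum_sq_norm_inner _).tsum_eq] using hsum
  have hK : Summable fun p : ι × ι =>
      ‖⟪b p.1, ContinuousLinearMap.adjoint B (S (b p.2))⟫_ℂ‖ ^ 2 := by
    rw [← (Equiv.prodComm ι ι).summable_iff]
    refine (summable_prod_of_nonneg fun p => sq_nonneg _).2 ⟨fun i =>
      (b.hasSum_sq_norm_inner (ContinuousLinearMap.adjoint B (S (b i)))).summable, ?_⟩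
    simp only [Equiv.prodComm_apply, Prod.swap,
      (b.hasSum_sq_norm_inner _).tsum_eq]
    refine Summable.of_nonneg_of_le (fun i => by positivity) (fun i => ?_)
      (hsum.mul_left (‖ContinuousLinearMap.adjoint B‖ ^ 2))
    rw [← mul_pow]
    gcongr
    exact ContinuousLinearMap.le_opNorm _ _
  have hF : Summable (Function.uncurry F) := by
    refine Summable.of_norm_bounded ((hG.add hK).mul_left (1 / 2)) fun p => ?_
    simp only [Function.uncurry, F, norm_mul, hadj]
    rw [norm_inner_symm, norm_inner_symm (ContinuousLinearMap.adjoint B _)]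
    nlinarith [sq_nonneg (‖⟪b p.2, S (b p.1)⟫_ℂ‖ -
      ‖⟪b p.1, ContinuousLinearMap.adjoint B (S (b p.2))⟫_ℂ‖)]
  calc ∑' i, ⟪b i, S (S (B (b i)))⟫_ℂ = ∑' i, ∑' j, F i j :=
        tsum_congr fun i => (hF1 i).tsum_eq.symm
    _ = ∑' j, ∑' i, F i j := hF.tsum_comm.symm
    _ = _ := tsum_congr fun j => (hF2 j).tsum_eq

/-- `ρ = ∑ᵢ |vᵢ⟩⟨vᵢ|` with `∑ᵢ ‖vᵢ‖² = 1`, together with the resulting formula for `tr (ρ B)`. -/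
structure IsEnsemble {ι : Type*} (ρ : H →L[ℂ] H) (v : ι → H) : Prop where
  hasSum_sq_norm : HasSum (fun i => ‖v i‖ ^ 2) 1
  hasSum_inner : ∀ φ ψ, HasSum (fun i => ⟪φ, v i⟫_ℂ * ⟪v i, ψ⟫_ℂ) ⟪φ, ρ ψ⟫_ℂ
  opTrace_mul : ∀ B : H →L[ℂ] H, opTrace (ρ * B) = ∑' i, ⟪v i, B (v i)⟫_ℂ

/-- A positive operator has a positive square root. -/
theorem ContinuousLinearMap.IsPositive.exists_sqrt {ρ : H →L[ℂ] H} (hρ : ρ.IsPositive) :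
    ∃ S : H →L[ℂ] H, S.IsPositive ∧ ∀ x, S (S x) = ρ x := by
  refine ⟨CFC.sqrt ρ, (ContinuousLinearMap.nonneg_iff_isPositive _).1 (CFC.sqrt_nonneg ρ),
    fun x => ?_⟩
  rw [← mul_apply_eq_comp,
    CFC.sqrt_mul_sqrt_self ρ ((ContinuousLinearMap.nonneg_iff_isPositive ρ).2 hρ)]

/-- Every state `ρ` is represented by the ensemble of the vectors `√ρ eᵢ`. -/
theorem IsState.exists_isEnsemble {ρ : H →L[ℂ] H} (hρ : IsState ρ) :
    ∃ v : (exists_hilbertBasis ℂ H).choose → H, IsEnsemble ρ v := by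
  set b := traceBasis H
  obtain ⟨S, hSp, hSS⟩ := hρ.isPositive.exists_sqrt
  have hS : ∀ x y, ⟪S x, y⟫_ℂ = ⟪x, S y⟫_ℂ := hSp.inner_left_eq_inner_right
  have hdiag : ∀ x, ⟪x, ρ x⟫_ℂ = ((‖S x‖ ^ 2 : ℝ) : ℂ) := fun x => by
    rw [← hSS, ← hS, inner_self_eq_ofReal_norm_sq]
  have htr := hρ.trace_eq_one
  rw [opTrace_eq_tsum_traceBasis] at htr
  have hsum : HasSum (fun i => ⟪b i, ρ (b i)⟫_ℂ) 1 := by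
    rw [← htr]
    -- A divergent trace would have the default value `0`, so trace one forces convergence.
    refine Summable.hasSum ?_
    by_contra h
    rw [tsum_eq_zero_of_not_summable h] at htr
    exact zero_ne_one htr
  simp only [hdiag] at hsum
  have hsum' : HasSum (fun i => ‖S (b i)‖ ^ 2) 1 := Complex.hasSum_ofReal.1 (by simpa using hsum)
  refine ⟨fun i => S (b i), hsum', fun φ ψ => ?_, fun B => ?_⟩
  · rw [← hSS, ← hS]
    simpa only [hS] using b.hasSum_inner_mul_inner (S φ) (S ψ)
  · simp only [opTrace_eq_tsum_traceBasis, mul_apply_eq_comp, ← hSS]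
    exact b.tsum_inner_comp_cyclic hS hsum'.summable B

namespace IsEnsemble

variable {ι : Type*} {ρ : H →L[ℂ] H} {v : ι → H}

/-- The terms are bounded by `‖B‖ ‖vᵢ‖²`, so the series for `tr (ρ B)` genuinely converges and its
sum is not a default value. -/
theorem hasSum_opTrace (h : IsEnsemble ρ v) (B : H →L[ℂ] H) :
    HasSum (fun i => ⟪v i, B (v i)⟫_ℂ) (opTrace (ρ * B)) := by
  rw [h.opTrace_mul]
  exact (Summable.of_norm_bounded (h.hasSum_sq_norm.summable.mul_left ‖B‖)
    (norm_inner_apply_self_le v B)).hasSum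

end IsEnsemble

end TraceClass

/-! ### Weyl relations and strong continuity of the Weyl operators. -/

section Weyl

variable {N : ℕ}

@[simp] theorem phasePos_add (x y : PhaseSpace N) : phasePos (x + y) = phasePos x + phasePos y := rfl

@[simp] theorem phaseMom_add (x y : PhaseSpace N) : phaseMom (x + y) = phaseMom x + phaseMom y := rfl

@[simp] theorem phasePos_neg (x : PhaseSpace N) : phasePos (-x) = -phasePos x := rfl

@[simp] theorem phaseMom_neg (x : PhaseSpace N) : phaseMom (-x) = -phaseMom x := rfl

@[simp] theorem phasePos_zero : phasePos (0 : PhaseSpace N) = 0 := rfl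

@[simp] theorem phaseMom_zero : phaseMom (0 : PhaseSpace N) = 0 := rfl

@[fun_prop] theorem continuous_phasePos : Continuous (phasePos : PhaseSpace N → ConfigSpace N) := by
  unfold phasePos
  fun_prop

@[fun_prop] theorem continuous_phaseMom : Continuous (phaseMom : PhaseSpace N → ConfigSpace N) := by
  unfold phaseMom
  fun_prop

/-- The symplectic form on phase space. -/
def symp (x y : PhaseSpace N) : ℝ :=
  ⟪phaseMom x, phasePos y⟫_ℝ - ⟪phaseMom y, phasePos x⟫_ℝ

/-- The linear map `J` with `⟪J x, y⟫ = symp x y`. -/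
def phaseRot : PhaseSpace N →ₗ[ℝ] PhaseSpace N where
  toFun x := WithLp.toLp 2 fun i => if i.2 = 0 then x (i.1, 1) else -x (i.1, 0)
  map_add' x y := by
    ext i
    by_cases h : i.2 = 0 <;> simp [h, add_comm]
  map_smul' c x := by
    ext i
    by_cases h : i.2 = 0 <;> simp [h]

theorem phaseRot_apply (x : PhaseSpace N) (i : Fin N × Fin 2) :
    phaseRot x i = if i.2 = 0 then x (i.1, 1) else -x (i.1, 0) := rfl

theorem inner_phaseRot_left (x y : PhaseSpace N) : ⟪phaseRot x, y⟫_ℝ = symp x y := by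
  simp only [symp, PiLp.inner_apply, Fintype.sum_prod_type, Fin.sum_univ_two, phaseRot_apply,
    phasePos, phaseMom, ← Finset.sum_sub_distrib]
  refine Finset.sum_congr rfl fun j _ => ?_
  simp
  ring

theorem phaseRot_phaseRot (x : PhaseSpace N) : phaseRot (phaseRot x) = -x := by
  ext ⟨j, k⟩
  fin_cases k <;> simp [phaseRot_apply]

theorem continuous_phaseRot : Continuous (phaseRot : PhaseSpace N → PhaseSpace N) :=
  LinearMap.continuous_of_finiteDimensional _

theorem norm_weyl_apply (x : PhaseSpace N) (ψ : ModeSpace N) : ‖weyl x ψ‖ = ‖ψ‖ :=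
  ((weylMul x).comp (weylShift x)).norm_map ψ

theorem inner_weyl_weyl (x : PhaseSpace N) (φ ψ : ModeSpace N) :
    ⟪weyl x φ, weyl x ψ⟫_ℂ = ⟪φ, ψ⟫_ℂ :=
  ((weylMul x).comp (weylShift x)).inner_map_map φ ψ

theorem weyl_zero : weyl (0 : PhaseSpace N) = 1 := by
  ext1 ψ
  apply Lp.ext
  filter_upwards [weyl_apply_ae 0 ψ] with t ht
  rw [ht]
  simp

/-- Translating the phase of `W(y)` by the position of `x` contributes `-p_y·q_x`. The symmetric
`-p·q/2` in the definition of `W` splits this cross term evenly, which leaves half the symplectic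
form. -/
theorem weyl_weyl (x y : PhaseSpace N) (ψ : ModeSpace N) :
    weyl x (weyl y ψ) = Complex.exp (Complex.I * (symp x y / 2 : ℝ)) • weyl (x + y) ψ := by
  apply Lp.ext
  filter_upwards [weyl_apply_ae x (weyl y ψ),
    (measurePreserving_sub_right volume (phasePos x)).quasiMeasurePreserving.ae
      (weyl_apply_ae y ψ), weyl_apply_ae (x + y) ψ,
    Lp.coeFn_smul (Complex.exp (Complex.I * (symp x y / 2 : ℝ))) (weyl (x + y) ψ)]
    with t h1 h2 h3 h4
  rw [h1, h2, h4, Pi.smul_apply, h3, smul_eq_mul, ← mul_assoc, ← mul_assoc, ← Complex.exp_add,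
    ← Complex.exp_add, phasePos_add, sub_sub]
  congr 2
  rw [← mul_add, ← mul_add]
  congr 1
  norm_cast
  simp only [symp, phaseMom_add, inner_add_left, inner_add_right, inner_sub_right]
  ring

theorem weyl_neg_weyl (x : PhaseSpace N) (ψ : ModeSpace N) : weyl (-x) (weyl x ψ) = ψ := by
  rw [weyl_weyl, neg_add_cancel, weyl_zero]
  simp [symp]

theorem weyl_weyl_neg (x : PhaseSpace N) (ψ : ModeSpace N) : weyl x (weyl (-x) ψ) = ψ := by
  simpa using weyl_neg_weyl (-x) ψ

theorem inner_weyl_left (x : PhaseSpace N) (φ ψ : ModeSpace N) :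
    ⟪weyl x φ, ψ⟫_ℂ = ⟪φ, weyl (-x) ψ⟫_ℂ := by
  rw [← inner_weyl_weyl x φ, weyl_weyl_neg]

theorem adjoint_weyl (x : PhaseSpace N) :
    ContinuousLinearMap.adjoint (weyl x) = weyl (-x) := by
  symm
  rw [ContinuousLinearMap.eq_adjoint_iff]
  intro φ ψ
  rw [inner_weyl_left, neg_neg]

/-- Conjugation of a Weyl operator by a Weyl operator multiplies it by a character. -/
theorem weyl_weyl_weyl_neg (x y : PhaseSpace N) (ψ : ModeSpace N) :
    weyl x (weyl y (weyl (-x) ψ)) = Complex.exp (Complex.I * symp x y) • weyl y ψ := by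
  rw [weyl_weyl y, map_smul, weyl_weyl, smul_smul, ← Complex.exp_add]
  congr 2
  · rw [← mul_add]
    congr 1
    norm_cast
    simp only [symp, phasePos_neg, phaseMom_neg, phasePos_add, phaseMom_add, inner_neg_left,
      inner_neg_right, inner_add_left, inner_add_right]
    ring
  · abel_nf

theorem continuous_inner_weylMul (φ ψ : ModeSpace N) :
    Continuous fun x : PhaseSpace N => ⟪φ, weylMul x ψ⟫_ℂ := by
  have h : ∀ x : PhaseSpace N, ⟪φ, weylMul x ψ⟫_ℂ =
      ∫ t, weylPhase x t * ⟪φ t, ψ t⟫_ℂ := fun x => by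
    rw [L2.inner_def]
    refine integral_congr_ae ?_
    filter_upwards [(memLp_weylPhase_mul x ψ).coeFn_toLp] with t ht
    change ⟪φ t, (memLp_weylPhase_mul x ψ).toLp _ t⟫_ℂ = _
    rw [ht, ← smul_eq_mul, inner_smul_right]
  simp only [h]
  refine continuous_of_dominated (bound := fun t => ‖⟪φ t, ψ t⟫_ℂ‖) (fun x => ?_) (fun x => ?_)
    (L2.integrable_inner φ ψ).norm ?_
  · exact (continuous_weylPhase x).aestronglyMeasurable.mul
      (L2.integrable_inner φ ψ).aestronglyMeasurable
  · exact Filter.Eventually.of_forall fun t => by rw [norm_mul, norm_weylPhase, one_mul]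
  · refine Filter.Eventually.of_forall fun t => ?_
    unfold weylPhase
    fun_prop

/-- A weakly continuous family of isometries is jointly continuous. -/
theorem Continuous.linearIsometry_apply {X H : Type*} [TopologicalSpace X] [NormedAddCommGroup H]
    [InnerProductSpace ℂ H] {V : X → H →ₗᵢ[ℂ] H}
    (hV : ∀ φ ψ, Continuous fun x => ⟪φ, V x ψ⟫_ℂ) {f : X → H} (hf : Continuous f) :
    Continuous fun x => V x (f x) := by
  rw [continuous_iff_continuousAt]
  intro x₀
  -- The square root is `‖V x (f x₀) - V x₀ (f x₀)‖`: since both vectors have norm `‖f x₀‖`,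
  -- expanding the square leaves only a matrix element, which is continuous in `x`.
  set g : X → ℝ := fun x =>
    ‖f x - f x₀‖ + √(2 * ‖f x₀‖ ^ 2 - 2 * (⟪V x₀ (f x₀), V x (f x₀)⟫_ℂ).re) with hg
  have hgc : Continuous g := by
    have := hV (V x₀ (f x₀)) (f x₀)
    fun_prop
  have hg0 : g x₀ = 0 := by
    have h : (⟪V x₀ (f x₀), V x₀ (f x₀)⟫_ℂ).re = ‖f x₀‖ ^ 2 := by
      rw [(V x₀).inner_map_map, inner_self_eq_ofReal_norm_sq, Complex.ofReal_re]
    simp only [hg, h]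
    simp
  rw [ContinuousAt, tendsto_iff_norm_sub_tendsto_zero]
  refine squeeze_zero (fun x => norm_nonneg _) (fun x => ?_) (hg0 ▸ hgc.tendsto x₀)
  calc ‖V x (f x) - V x₀ (f x₀)‖ = ‖V x (f x - f x₀) + (V x (f x₀) - V x₀ (f x₀))‖ := by
        rw [map_sub, sub_add_sub_cancel]
    _ ≤ ‖f x - f x₀‖ + ‖V x (f x₀) - V x₀ (f x₀)‖ := by
        rw [← (V x).norm_map (f x - f x₀)]
        exact norm_add_le _ _
    _ = g x := by
        simp only [hg]
        congr 1
        rw [← Real.sqrt_sq (norm_nonneg (V x (f x₀) - V x₀ (f x₀))), @norm_sub_sq ℂ,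
          LinearIsometry.norm_map, LinearIsometry.norm_map, inner_re_symm]
        congr 1
        simp only [RCLike.re_to_complex]
        ring

/-- Translations act strongly continuously on `L²`, and the multiplications are a weakly continuous
family of isometries, hence may be applied to a continuously varying vector. -/
theorem continuous_weyl_apply (ψ : ModeSpace N) :
    Continuous fun x : PhaseSpace N => weyl x ψ := by
  refine Continuous.linearIsometry_apply (V := weylMul) continuous_inner_weylMul ?_
  let g : PhaseSpace N → C(ConfigSpace N, ConfigSpace N) := fun x =>
    ⟨fun t => t - phasePos x, by fun_prop⟩
  have hg : Continuous g := by
    refine ContinuousMap.continuous_of_continuous_uncurry _ ?_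
    change Continuous fun p : PhaseSpace N × ConfigSpace N => p.2 - phasePos p.1
    fun_prop
  exact Continuous.compMeasurePreservingLp (f := fun _ : PhaseSpace N => ψ) (g := g)
    continuous_const hg (fun x => measurePreserving_sub_right volume (phasePos x)) (by norm_num)

end Weyl

/-! ### Plancherel's theorem for functions in `L¹ ∩ L²`. -/

section Plancherel

open FourierTransform SchwartzMap
open scoped ContDiff

variable {V : Type*} [NormedAddCommGroup V] [InnerProductSpace ℝ V] [FiniteDimensional ℝ V]
  [MeasurableSpace V] [BorelSpace V]

theorem lintegral_enorm_sq_eq_eLpNorm {α E : Type*} [MeasurableSpace α] [NormedAddCommGroup E]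
    (μ : Measure α) (f : α → E) : ∫⁻ x, ‖f x‖ₑ ^ 2 ∂μ = eLpNorm f 2 μ ^ 2 := by
  have h := eLpNorm_nnreal_pow_eq_lintegral (f := f) (μ := μ) (p := 2) (by norm_num)
  simpa using h.symm

theorem lintegral_enorm_sq_coeFn {α E : Type*} [MeasurableSpace α] [NormedAddCommGroup E]
    {μ : Measure α} (f : Lp E 2 μ) : ∫⁻ x, ‖f x‖ₑ ^ 2 ∂μ = ‖f‖ₑ ^ 2 := by
  rw [lintegral_enorm_sq_eq_eLpNorm, Lp.enorm_def]

/-- The Fourier integral of a function in `L¹ ∩ L²` is its `L²` Fourier transform. -/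
theorem fourier_toLp_ae_eq {f : V → ℂ} (hf : Integrable f) (hf2 : MemLp f 2) :
    𝓕 f =ᵐ[volume] (𝓕 (hf2.toLp f) : Lp ℂ 2 (volume : Measure V)) := by
  have hcont : Continuous (𝓕 f) :=
    VectorFourier.fourierIntegral_continuous Real.continuous_fourierChar continuous_inner hf
  -- Both sides are compared on smooth test functions. The Fourier integral passes to the test
  -- function by Fubini, the `L²` transform by its definition as a tempered distribution.
  refine ae_eq_of_integral_contDiff_smul_eq hcont.locallyIntegrable
    ((Lp.memLp _).locallyIntegrable (by norm_num)) fun g hg hgs => ?_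
  have hgs' : HasCompactSupport fun x => (g x : ℂ) := hgs.comp_left Complex.ofReal_zero
  have hg' : ContDiff ℝ ∞ fun x => (g x : ℂ) := Complex.ofRealCLM.contDiff.comp hg
  set s : 𝓢(V, ℂ) := hgs'.toSchwartzMap hg' with hs
  have hsg : ∀ x, s x = g x := fun x => rfl
  have h1 := congrArg (fun T => T s) (Lp.fourier_toTemperedDistribution_eq (hf2.toLp f))
  simp only [TemperedDistribution.fourier_apply, Lp.toTemperedDistribution_apply] at h1
  calc ∫ x, g x • 𝓕 f x = ∫ x, 𝓕 f x • s x := by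
        refine integral_congr_ae (Filter.Eventually.of_forall fun x => ?_)
        simp only [hsg, Complex.real_smul, smul_eq_mul, mul_comm]
    _ = ∫ x, f x • 𝓕 (s : V → ℂ) x := by
        have := VectorFourier.integral_fourierIntegral_smul_eq_flip (L := innerₗ V)
          Real.continuous_fourierChar continuous_inner hf (s.integrable (μ := volume))
        rw [flip_innerₗ] at this
        exact this
    _ = ∫ x, 𝓕 s x • hf2.toLp f x := by
        refine integral_congr_ae ?_
        filter_upwards [hf2.coeFn_toLp] with x hx
        rw [hx, SchwartzMap.fourier_coe, smul_eq_mul, smul_eq_mul, mul_comm]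
    _ = _ := by
        rw [h1]
        refine integral_congr_ae (Filter.Eventually.of_forall fun x => ?_)
        simp only [hsg, Complex.real_smul, smul_eq_mul]

/-- Plancherel's theorem for functions in `L¹ ∩ L²`. -/
theorem lintegral_enorm_fourier_sq {f : V → ℂ} (hf : Integrable f) (hf2 : MemLp f 2) :
    ∫⁻ ξ, ‖𝓕 f ξ‖ₑ ^ 2 = ∫⁻ x, ‖f x‖ₑ ^ 2 := by
  rw [lintegral_enorm_sq_eq_eLpNorm, lintegral_enorm_sq_eq_eLpNorm,
    eLpNorm_congr_ae (fourier_toLp_ae_eq hf hf2), ← eLpNorm_congr_ae hf2.coeFn_toLp,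
    ← Lp.enorm_def, ← Lp.enorm_def, ← ofReal_norm, ← ofReal_norm, Lp.norm_fourier_eq]

theorem lintegral_comp_const_smul {r : ℝ} (hr : r ≠ 0) {f : V → ENNReal} (hf : Measurable f) :
    ∫⁻ x, f (r • x) = ENNReal.ofReal |(r ^ Module.finrank ℝ V)⁻¹| * ∫⁻ x, f x := by
  rw [← lintegral_map hf (measurable_const_smul r), Measure.map_addHaar_smul _ hr,
    lintegral_smul_measure, smul_eq_mul]

end Plancherel

/-! ### Square integrability and orthogonality relations of the Weyl operators. -/

section Moyal

open FourierTransform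

variable {N : ℕ}

/-- The phase space point with position `z.1` and momentum `z.2`. -/
def phasePoint (z : ConfigSpace N × ConfigSpace N) : PhaseSpace N :=
  WithLp.toLp 2 fun i => if i.2 = 0 then z.1 i.1 else z.2 i.1

@[simp] theorem phasePos_phasePoint (z : ConfigSpace N × ConfigSpace N) :
    phasePos (phasePoint z) = z.1 := by
  ext j
  simp [phasePos, phasePoint]

@[simp] theorem phaseMom_phasePoint (z : ConfigSpace N × ConfigSpace N) :
    phaseMom (phasePoint z) = z.2 := by
  ext j
  simp [phaseMom, phasePoint]

theorem phasePoint_eta (x : PhaseSpace N) : phasePoint (phasePos x, phaseMom x) = x := by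
  ext ⟨j, k⟩
  fin_cases k <;> simp [phasePoint, phasePos, phaseMom]

theorem measurePreserving_phasePoint :
    MeasurePreserving (phasePoint : ConfigSpace N × ConfigSpace N → PhaseSpace N) := by
  let e : WithLp 2 (ConfigSpace N × ConfigSpace N) ≃ₗᵢ[ℝ] PhaseSpace N :=
    { toFun := fun z => phasePoint (WithLp.ofLp z)
      invFun := fun x => WithLp.toLp 2 (phasePos x, phaseMom x)
      left_inv := fun z => by simp; rfl
      right_inv := fun x => phasePoint_eta x
      map_add' := fun z w => by
        ext i
        by_cases h : i.2 = 0 <;> simp [phasePoint, h]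
      map_smul' := fun c z => by
        ext i
        by_cases h : i.2 = 0 <;> simp [phasePoint, h]
      norm_map' := fun z => by
        rw [← sq_eq_sq₀ (norm_nonneg _) (norm_nonneg _), WithLp.prod_norm_sq_eq_of_L2,
          EuclideanSpace.norm_sq_eq, EuclideanSpace.norm_sq_eq, EuclideanSpace.norm_sq_eq]
        simp [phasePoint, Fintype.sum_prod_type, Finset.sum_add_distrib] }
  exact e.measurePreserving.comp (WithLp.volume_preserving_toLp _ _)

/-- The product whose Fourier transform gives matrix elements of Weyl operators. -/
def weylProd (φ ψ : ModeSpace N) (q t : ConfigSpace N) : ℂ := starRingEnd ℂ (φ t) * ψ (t - q)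

/-- For fixed `q` the matrix element is, up to a phase, a Fourier transform in `p`. The frequency
`-p/(2π)` adapts to the kernel `e^{-2πi⟨t,ξ⟩}`, and rescaling it is the source of the factor
`(2π)^N` in the orthogonality relations. -/
theorem enorm_inner_weyl_phasePoint (φ ψ : ModeSpace N) (q p : ConfigSpace N) :
    ‖⟪φ, weyl (phasePoint (q, p)) ψ⟫_ℂ‖ₑ = ‖𝓕 (weylProd φ ψ q) ((-(2 * Real.pi)⁻¹) • p)‖ₑ := by
  have h : ⟪φ, weyl (phasePoint (q, p)) ψ⟫_ℂ =
      Complex.exp ((-(⟪p, q⟫_ℝ / 2) : ℝ) * Complex.I) *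
        𝓕 (weylProd φ ψ q) ((-(2 * Real.pi)⁻¹) • p) := by
    rw [L2.inner_def, Real.fourier_eq', ← integral_const_mul]
    refine integral_congr_ae ?_
    filter_upwards [weyl_apply_ae (phasePoint (q, p)) ψ] with t ht
    rw [ht, smul_eq_mul, ← mul_assoc, ← Complex.exp_add, weylProd, RCLike.inner_apply,
      phasePos_phasePoint, phaseMom_phasePoint]
    have : Complex.I * ((⟪p, t⟫_ℝ - ⟪p, q⟫_ℝ / 2 : ℝ) : ℂ) =
        (-(⟪p, q⟫_ℝ / 2) : ℝ) * Complex.I +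
          ((-2 * Real.pi * ⟪t, (-(2 * Real.pi)⁻¹) • p⟫_ℝ : ℝ) : ℂ) * Complex.I := by
      rw [← add_mul, mul_comm, ← Complex.ofReal_add]
      congr 2
      rw [inner_smul_right, real_inner_comm p t]
      field_simp
      ring
    rw [this]
    ring
  rw [h, enorm_mul, ← ofReal_norm, Complex.norm_exp_ofReal_mul_I]
  simp

theorem integrable_weylProd (φ ψ : ModeSpace N) (q : ConfigSpace N) :
    Integrable (weylProd φ ψ q) := by
  have hψ : MemLp (fun t => ψ (t - q)) 2 volume :=
    (Lp.memLp ψ).comp_measurePreserving (measurePreserving_sub_right volume q)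
  exact MemLp.integrable_mul (Lp.memLp φ).star hψ

theorem measurable_enorm_weylProd_sq (φ ψ : ModeSpace N) :
    Measurable fun z : ConfigSpace N × ConfigSpace N => ‖weylProd φ ψ z.1 z.2‖ₑ ^ 2 := by
  have hφ : Measurable φ := (Lp.stronglyMeasurable φ).measurable
  have hψ : Measurable ψ := (Lp.stronglyMeasurable ψ).measurable
  have h1 : Measurable fun z : ConfigSpace N × ConfigSpace N => ψ (z.2 - z.1) :=
    hψ.comp (measurable_snd.sub measurable_fst)
  have h2 : Measurable fun z : ConfigSpace N × ConfigSpace N => starRingEnd ℂ (φ z.2) :=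
    Complex.continuous_conj.measurable.comp (hφ.comp measurable_snd)
  exact (h2.mul h1).enorm.pow_const 2

theorem lintegral_lintegral_enorm_weylProd_sq (φ ψ : ModeSpace N) :
    ∫⁻ q, ∫⁻ t, ‖weylProd φ ψ q t‖ₑ ^ 2 = ‖φ‖ₑ ^ 2 * ‖ψ‖ₑ ^ 2 := by
  have hφ : Measurable fun t => ‖φ t‖ₑ ^ 2 := (Lp.stronglyMeasurable φ).measurable.enorm.pow_const 2
  have hψ : Measurable fun t => ‖ψ t‖ₑ ^ 2 := (Lp.stronglyMeasurable ψ).measurable.enorm.pow_const 2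
  have h : ∀ q t, ‖weylProd φ ψ q t‖ₑ ^ 2 = ‖φ t‖ₑ ^ 2 * ‖ψ (t - q)‖ₑ ^ 2 := fun q t => by
    rw [weylProd, enorm_mul, mul_pow, RCLike.enorm_conj]
  simp only [h]
  rw [lintegral_lintegral_swap]
  · have h2 : ∀ t, ∫⁻ q, ‖φ t‖ₑ ^ 2 * ‖ψ (t - q)‖ₑ ^ 2 = ‖φ t‖ₑ ^ 2 * ‖ψ‖ₑ ^ 2 := fun t => by
      have hm : Measurable fun q => ‖ψ (t - q)‖ₑ ^ 2 := hψ.comp (measurable_const_sub t)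
      rw [lintegral_const_mul _ hm,
        lintegral_sub_left_eq_self (fun t => ‖ψ t‖ₑ ^ 2) t, lintegral_enorm_sq_coeFn]
    simp only [h2]
    rw [lintegral_mul_const _ hφ, lintegral_enorm_sq_coeFn]
  · have hm := (measurable_enorm_weylProd_sq φ ψ).aemeasurable (μ := volume.prod volume)
    simp only [h] at hm
    exact hm

theorem continuous_inner_weyl (φ ψ : ModeSpace N) :
    Continuous fun x : PhaseSpace N => ⟪φ, weyl x ψ⟫_ℂ :=
  continuous_const.inner (continuous_weyl_apply ψ)

/-- Square integrability of the Weyl representation. -/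
theorem lintegral_enorm_inner_weyl_sq (φ ψ : ModeSpace N) :
    ∫⁻ x, ‖⟪φ, weyl x ψ⟫_ℂ‖ₑ ^ 2 =
      ENNReal.ofReal ((2 * Real.pi) ^ N) * (‖φ‖ₑ ^ 2 * ‖ψ‖ₑ ^ 2) := by
  have hm : Measurable fun x : PhaseSpace N => ‖⟪φ, weyl x ψ⟫_ℂ‖ₑ ^ 2 :=
    (continuous_inner_weyl φ ψ).measurable.enorm.pow_const 2
  have hm' : Measurable fun z : ConfigSpace N × ConfigSpace N =>
      ‖⟪φ, weyl (phasePoint z) ψ⟫_ℂ‖ₑ ^ 2 := hm.comp measurePreserving_phasePoint.measurable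
  rw [← measurePreserving_phasePoint.lintegral_comp hm, Measure.volume_eq_prod,
    lintegral_prod _ hm'.aemeasurable]
  -- The product of two `L²` functions is only in `L¹` for a given `q`. Finiteness of the double
  -- integral puts it in `L²` for almost every `q`, as Plancherel requires.
  have hfin : ∀ᵐ q, ∫⁻ t, ‖weylProd φ ψ q t‖ₑ ^ 2 < ⊤ := by
    refine ae_lt_top (measurable_enorm_weylProd_sq φ ψ).lintegral_prod_right' ?_
    rw [lintegral_lintegral_enorm_weylProd_sq]
    finiteness
  have hq : ∀ᵐ q : ConfigSpace N, ∫⁻ p, ‖⟪φ, weyl (phasePoint (q, p)) ψ⟫_ℂ‖ₑ ^ 2 =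
      ENNReal.ofReal ((2 * Real.pi) ^ N) * ∫⁻ t, ‖weylProd φ ψ q t‖ₑ ^ 2 := by
    filter_upwards [hfin] with q hq
    have hL1 := integrable_weylProd φ ψ q
    have hL2 : MemLp (weylProd φ ψ q) 2 := by
      refine ⟨hL1.aestronglyMeasurable, ?_⟩
      rw [lintegral_enorm_sq_eq_eLpNorm] at hq
      exact (ENNReal.pow_lt_top_iff.1 hq).resolve_right two_ne_zero
    have hcont : Continuous (𝓕 (weylProd φ ψ q)) :=
      VectorFourier.fourierIntegral_continuous Real.continuous_fourierChar continuous_inner hL1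
    have hr : -(2 * Real.pi)⁻¹ ≠ 0 := by simp [Real.pi_ne_zero]
    simp only [enorm_inner_weyl_phasePoint]
    rw [lintegral_comp_const_smul hr (f := fun ξ => ‖𝓕 (weylProd φ ψ q) ξ‖ₑ ^ 2)
      (hcont.measurable.enorm.pow_const 2), lintegral_enorm_fourier_sq hL1 hL2]
    congr 2
    rw [finrank_euclideanSpace_fin, abs_inv, abs_pow, abs_neg, abs_inv,
      abs_of_pos Real.two_pi_pos, inv_pow, inv_inv]
  rw [lintegral_congr_ae hq, lintegral_const_mul' _ _ ENNReal.ofReal_ne_top,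
    lintegral_lintegral_enorm_weylProd_sq]

theorem memLp_inner_weyl (φ ψ : ModeSpace N) :
    MemLp (fun x : PhaseSpace N => ⟪φ, weyl x ψ⟫_ℂ) 2 volume := by
  refine ⟨(continuous_inner_weyl φ ψ).aestronglyMeasurable, ?_⟩
  have h := lintegral_enorm_inner_weyl_sq φ ψ
  rw [lintegral_enorm_sq_eq_eLpNorm] at h
  refine (ENNReal.pow_lt_top_iff (n := 2).1 ?_).resolve_right two_ne_zero
  rw [h]
  finiteness

theorem integral_norm_inner_weyl_sq (φ ψ : ModeSpace N) :
    ∫ x, ‖⟪φ, weyl x ψ⟫_ℂ‖ ^ 2 = (2 * Real.pi) ^ N * (‖φ‖ ^ 2 * ‖ψ‖ ^ 2) := by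
  rw [integral_eq_lintegral_of_nonneg_ae (Filter.Eventually.of_forall fun x => sq_nonneg _)
    ((continuous_inner_weyl φ ψ).norm.pow 2).aestronglyMeasurable]
  have h := lintegral_enorm_inner_weyl_sq φ ψ
  simp only [← ofReal_norm, ← ENNReal.ofReal_pow (norm_nonneg _)] at h
  rw [h, ← ENNReal.ofReal_mul (by positivity), ← ENNReal.ofReal_mul (by positivity),
    ENNReal.toReal_ofReal (by positivity)]

/-- Polarization: a sesquilinear form that is a multiple of the inner product on the diagonal is
that multiple of the inner product. -/
theorem sesq_eq_mul_inner_of_diag {H : Type*} [NormedAddCommGroup H] [InnerProductSpace ℂ H]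
    {S : H → H → ℂ} {k : ℂ} (hadd_left : ∀ x y z, S (x + y) z = S x z + S y z)
    (hadd_right : ∀ x y z, S x (y + z) = S x y + S x z)
    (hsmul_left : ∀ (c : ℂ) x y, S (c • x) y = starRingEnd ℂ c * S x y)
    (hsmul_right : ∀ (c : ℂ) x y, S x (c • y) = c * S x y)
    (hdiag : ∀ x, S x x = k * ⟪x, x⟫_ℂ) (x y : H) : S x y = k * ⟪x, y⟫_ℂ := by
  have h1 := hdiag (x + y)
  have h2 := hdiag (x + Complex.I • y)
  simp only [hadd_left, hadd_right, hsmul_left, hsmul_right, hdiag, inner_add_left,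
    inner_add_right, inner_smul_left, inner_smul_right, Complex.conj_I] at h1 h2
  linear_combination (1 / 2) * h1 - (Complex.I / 2) * h2 +
    (1 / 2) * (S x y - S y x - k * ⟪x, y⟫_ℂ + k * ⟪y, x⟫_ℂ) * Complex.I_sq

theorem integrable_inner_weyl_mul (φ₁ ψ₁ φ₂ ψ₂ : ModeSpace N) :
    Integrable fun x : PhaseSpace N => ⟪weyl x ψ₂, φ₂⟫_ℂ * ⟪φ₁, weyl x ψ₁⟫_ℂ := by
  have h : MemLp (fun x : PhaseSpace N => ⟪weyl x ψ₂, φ₂⟫_ℂ) 2 volume := by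
    simpa only [← inner_conj_symm φ₂, Pi.star_def, RCLike.star_def, RCLike.conj_conj] using
      (memLp_inner_weyl φ₂ ψ₂).star
  exact MemLp.integrable_mul h (memLp_inner_weyl φ₁ ψ₁)

/-- The orthogonality relations of the Weyl operators. -/
theorem integral_inner_weyl_mul_inner_weyl (φ₁ ψ₁ φ₂ ψ₂ : ModeSpace N) :
    ∫ x, ⟪weyl x ψ₂, φ₂⟫_ℂ * ⟪φ₁, weyl x ψ₁⟫_ℂ =
      ((2 * Real.pi) ^ N : ℝ) * ⟪φ₁, φ₂⟫_ℂ * ⟪ψ₂, ψ₁⟫_ℂ := by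
  have hI := integrable_inner_weyl_mul (N := N)
  have hdiag : ∀ φ ψ : ModeSpace N, ∫ x, ⟪weyl x ψ, φ⟫_ℂ * ⟪φ, weyl x ψ⟫_ℂ =
      ((2 * Real.pi) ^ N : ℝ) * ⟪ψ, ψ⟫_ℂ * ⟪φ, φ⟫_ℂ := fun φ ψ => by
    have h : ∀ x : PhaseSpace N, ⟪weyl x ψ, φ⟫_ℂ * ⟪φ, weyl x ψ⟫_ℂ =
        ((‖⟪φ, weyl x ψ⟫_ℂ‖ ^ 2 : ℝ) : ℂ) := fun x => by
      rw [← inner_conj_symm, ← Complex.normSq_eq_conj_mul_self, Complex.normSq_eq_norm_sq]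
    simp only [h]
    rw [integral_complex_ofReal, integral_norm_inner_weyl_sq, inner_self_eq_ofReal_norm_sq,
      inner_self_eq_ofReal_norm_sq]
    push_cast
    ring
  -- Polarization is applied twice: first in the outer vectors with `ψ` fixed, then in the vectors
  -- on which the Weyl operators act.
  have hφ : ∀ ψ : ModeSpace N, ∫ x, ⟪weyl x ψ, φ₂⟫_ℂ * ⟪φ₁, weyl x ψ⟫_ℂ =
      ((2 * Real.pi) ^ N : ℝ) * ⟪ψ, ψ⟫_ℂ * ⟪φ₁, φ₂⟫_ℂ := fun ψ => by
    refine sesq_eq_mul_inner_of_diag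
      (S := fun φ₁ φ₂ => ∫ x, ⟪weyl x ψ, φ₂⟫_ℂ * ⟪φ₁, weyl x ψ⟫_ℂ)
      (fun x y z => ?_) (fun x y z => ?_) (fun c x y => ?_) (fun c x y => ?_)
      (fun φ => hdiag φ ψ) φ₁ φ₂
    · simp only [inner_add_left, mul_add]
      exact integral_add (hI _ _ _ _) (hI _ _ _ _)
    · simp only [inner_add_right, add_mul]
      exact integral_add (hI _ _ _ _) (hI _ _ _ _)
    · simp only [inner_smul_left, mul_left_comm _ (starRingEnd ℂ c)]
      exact integral_const_mul _ _
    · simp only [inner_smul_right, mul_assoc]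
      exact integral_const_mul _ _
  refine sesq_eq_mul_inner_of_diag
    (S := fun ψ₂ ψ₁ => ∫ x, ⟪weyl x ψ₂, φ₂⟫_ℂ * ⟪φ₁, weyl x ψ₁⟫_ℂ)
    (fun x y z => ?_) (fun x y z => ?_) (fun c x y => ?_) (fun c x y => ?_)
    (fun ψ => (hφ ψ).trans (by ring)) ψ₂ ψ₁
  · simp only [map_add, inner_add_left, add_mul]
    exact integral_add (hI _ _ _ _) (hI _ _ _ _)
  · simp only [map_add, inner_add_right, mul_add]
    exact integral_add (hI _ _ _ _) (hI _ _ _ _)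
  · simp only [map_smul, inner_smul_left, mul_assoc]
    exact integral_const_mul _ _
  · simp only [map_smul, inner_smul_right, mul_left_comm _ c]
    exact integral_const_mul _ _

end Moyal

/-! ### Continuity and injectivity of the Weyl transform on states. -/

section WeylTransform

variable {N : ℕ}

instance : SecondCountableTopology (ModeSpace N) :=
  haveI : Fact ((2 : ENNReal) ≠ ⊤) := ⟨ENNReal.ofNat_ne_top⟩
  Lp.SecondCountableTopology

instance : Countable (exists_hilbertBasis ℂ (ModeSpace N)).choose :=
  (traceBasis (ModeSpace N)).orthonormal.countable_of_separableSpace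

theorem opTrace_mul_smul (ρ B : ModeSpace N →L[ℂ] ModeSpace N) (c : ℂ) :
    opTrace (ρ * (c • B)) = c * opTrace (ρ * B) := by
  simp only [opTrace, mul_apply_eq_comp, smul_apply, map_smul,
    inner_smul_right]
  exact tsum_mul_left

/-- The transform is a series of continuous matrix elements dominated by the summable constants
`‖vᵢ‖²`, so it converges uniformly. -/
theorem IsState.continuous_weylTransform {ρ : ModeSpace N →L[ℂ] ModeSpace N} (hρ : IsState ρ) :
    Continuous (weylTransform ρ) := by
  obtain ⟨v, hv⟩ := hρ.exists_isEnsemble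
  have h : weylTransform ρ = fun x => ∑' i, ⟪v i, weyl x (v i)⟫_ℂ := by
    ext x
    exact hv.opTrace_mul _
  rw [h]
  refine continuous_tsum (fun i => continuous_inner_weyl _ _) hv.hasSum_sq_norm.summable
    fun i x => ?_
  refine (norm_inner_le_norm _ _).trans_eq ?_
  rw [norm_weyl_apply, sq]

/-- Cauchy-Schwarz and the square integral formula. With `ψ₁ = ψ₂ = vᵢ`, or with `φ₁ = ψ₁ = vᵢ`, the
bound is proportional to `‖vᵢ‖²`, which justifies exchanging sum and integral. -/
theorem integral_norm_inner_weyl_mul_le (φ₁ ψ₁ φ₂ ψ₂ : ModeSpace N) :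
    ∫ x, ‖⟪weyl x ψ₂, φ₂⟫_ℂ * ⟪φ₁, weyl x ψ₁⟫_ℂ‖ ≤
      (2 * Real.pi) ^ N * (‖φ₂‖ * ‖ψ₂‖ * (‖φ₁‖ * ‖ψ₁‖)) := by
  have h := integral_mul_norm_le_Lp_mul_Lq (μ := volume) Real.HolderConjugate.two_two
    (f := fun x : PhaseSpace N => ⟪φ₂, weyl x ψ₂⟫_ℂ) (g := fun x => ⟪φ₁, weyl x ψ₁⟫_ℂ)
    (by simpa using memLp_inner_weyl φ₂ ψ₂) (by simpa using memLp_inner_weyl φ₁ ψ₁)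
  simp only [Real.rpow_two, integral_norm_inner_weyl_sq, ← Real.sqrt_eq_rpow] at h
  simp only [norm_mul, norm_inner_symm (weyl _ ψ₂)]
  refine h.trans_eq ?_
  rw [← mul_pow, ← mul_pow, Real.sqrt_mul (by positivity), Real.sqrt_mul (by positivity),
    Real.sqrt_sq (by positivity), Real.sqrt_sq (by positivity)]
  have hc := Real.mul_self_sqrt (show 0 ≤ (2 * Real.pi) ^ N by positivity)
  linear_combination (‖φ₂‖ * ‖ψ₂‖ * (‖φ₁‖ * ‖ψ₁‖)) * hc

/-- The inversion formula for the Weyl transform of a state. -/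
theorem IsState.integral_mul_weylTransform {ρ : ModeSpace N →L[ℂ] ModeSpace N} (hρ : IsState ρ)
    (φ ψ : ModeSpace N) :
    ∫ x, ⟪weyl x ψ, φ⟫_ℂ * weylTransform ρ x = ((2 * Real.pi) ^ N : ℝ) * ⟪ψ, ρ φ⟫_ℂ := by
  obtain ⟨v, hv⟩ := hρ.exists_isEnsemble
  have hsum := hasSum_integral_of_summable_integral_norm (μ := (volume : Measure (PhaseSpace N)))
    (F := fun i x => ⟪weyl x ψ, φ⟫_ℂ * ⟪v i, weyl x (v i)⟫_ℂ)
    (fun i => integrable_inner_weyl_mul _ _ _ _) (by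
      refine Summable.of_nonneg_of_le (fun i => integral_nonneg fun x => norm_nonneg _)
        (fun i => integral_norm_inner_weyl_mul_le _ _ _ _) ?_
      simp only [← sq]
      exact (hv.hasSum_sq_norm.summable.mul_left _).mul_left _)
  have h1 : ∀ x : PhaseSpace N, ∑' i, ⟪weyl x ψ, φ⟫_ℂ * ⟪v i, weyl x (v i)⟫_ℂ =
      ⟪weyl x ψ, φ⟫_ℂ * weylTransform ρ x := fun x => by
    rw [tsum_mul_left, weylTransform, hv.opTrace_mul]
  simp only [h1, integral_inner_weyl_mul_inner_weyl] at hsum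
  refine hsum.unique ?_
  simpa only [mul_assoc, mul_comm ⟪ψ, v _⟫_ℂ] using
    (hv.hasSum_inner ψ φ).mul_left (((2 * Real.pi) ^ N : ℝ) : ℂ)

/-- A state is determined by its Weyl transform. -/
theorem IsState.eq_of_weylTransform_eq {ρ₁ ρ₂ : ModeSpace N →L[ℂ] ModeSpace N} (h₁ : IsState ρ₁)
    (h₂ : IsState ρ₂) (h : weylTransform ρ₁ = weylTransform ρ₂) : ρ₁ = ρ₂ := by
  ext1 φ
  refine ext_inner_left ℂ fun ψ => ?_
  have e := h₁.integral_mul_weylTransform φ ψ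
  rw [h, h₂.integral_mul_weylTransform φ ψ] at e
  have hc : (((2 * Real.pi) ^ N : ℝ) : ℂ) ≠ 0 := by
    exact_mod_cast (pow_pos Real.two_pi_pos N).ne'
  exact (mul_left_cancel₀ hc e).symm

end WeylTransform

/-! ### Outcome distributions and their characteristic functions. -/

section Outcome

variable {N : ℕ} {α : Type*} [MeasurableSpace α]

theorem Observable.inner_eff_self (E : Observable N α) (ψ : ModeSpace N) {X : Set α}
    (hX : MeasurableSet X) : ⟪ψ, E.eff X ψ⟫_ℂ = ((⟪ψ, E.eff X ψ⟫_ℂ).re : ℂ) :=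
  (Complex.eq_re_of_ofReal_le ((E.isPositive X hX).inner_nonneg_right ψ))

theorem Observable.diagMeasure_univ (E : Observable N α) (ψ : ModeSpace N) :
    E.diagMeasure ψ Set.univ = ENNReal.ofReal (‖ψ‖ ^ 2) := by
  rw [E.diagMeasure_apply ψ MeasurableSet.univ, E.eff_univ, one_apply_eq_self,
    inner_self_eq_ofReal_norm_sq, Complex.ofReal_re]

instance (E : Observable N α) (ψ : ModeSpace N) : IsFiniteMeasure (E.diagMeasure ψ) :=
  ⟨by rw [E.diagMeasure_univ]; exact ENNReal.ofReal_lt_top⟩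

/-- The outcome distribution `X ↦ tr (ρ E(X))` is a finite measure, and its characteristic
function is `tr (ρ Ê(p))`. -/
theorem Observable.exists_outcome_measure [NormedAddCommGroup α] [InnerProductSpace ℝ α]
    [BorelSpace α] (E : Observable N α) {ρ : ModeSpace N →L[ℂ] ModeSpace N} (hρ : IsState ρ) :
    ∃ μ : Measure α, IsFiniteMeasure μ ∧
      (∀ X, MeasurableSet X → opTrace (ρ * E.eff X) = (μ.real X : ℂ)) ∧
      ∀ (p : α) (T : ModeSpace N →L[ℂ] ModeSpace N),
        (∀ ψ, ⟪ψ, T ψ⟫_ℂ = charFun (E.diagMeasure ψ) p) → charFun μ p = opTrace (ρ * T) := by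
  obtain ⟨v, hv⟩ := hρ.exists_isEnsemble
  -- The outcome distribution is the sum of those of the vectors `vᵢ`, with total mass `∑ ‖vᵢ‖²`.
  have hfin : IsFiniteMeasure (Measure.sum fun i => E.diagMeasure (v i)) := by
    refine ⟨?_⟩
    rw [Measure.sum_apply _ MeasurableSet.univ]
    simp only [E.diagMeasure_univ]
    rw [← ENNReal.ofReal_tsum_of_nonneg (fun i => sq_nonneg _) hv.hasSum_sq_norm.summable]
    exact ENNReal.ofReal_lt_top
  refine ⟨Measure.sum fun i => E.diagMeasure (v i), hfin, fun X hX => ?_, fun p T hT => ?_⟩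
  · have h := hv.hasSum_opTrace (E.eff X)
    have hre := Complex.hasSum_re h
    rw [Measure.real, Measure.sum_apply _ hX]
    simp only [E.diagMeasure_apply _ hX]
    have hpos : ∀ i, 0 ≤ (⟪v i, E.eff X (v i)⟫_ℂ).re := fun i =>
      (E.isPositive X hX).re_inner_nonneg_right (v i)
    rw [← ENNReal.ofReal_tsum_of_nonneg hpos hre.summable,
      ENNReal.toReal_ofReal (tsum_nonneg hpos), Complex.ofReal_tsum, ← h.tsum_eq]
    exact tsum_congr fun i => E.inner_eff_self _ hX
  · have hint : Integrable (fun x => Complex.exp (⟪x, p⟫_ℝ * Complex.I))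
        (Measure.sum fun i => E.diagMeasure (v i)) := by
      refine Integrable.of_bound (C := 1) ?_ (Filter.Eventually.of_forall fun x => ?_)
      · exact Continuous.aestronglyMeasurable (by fun_prop)
      · rw [Complex.norm_exp_ofReal_mul_I]
    have h := hasSum_integral_measure hint
    simp only [← charFun_apply, ← hT] at h
    exact h.unique (hv.hasSum_opTrace T)

/-- Two states have the same outcome distributions if and only if the characteristic functions
of these distributions agree. -/
theorem Observable.forall_opTrace_eff_eq_iff [NormedAddCommGroup α] [InnerProductSpace ℝ α]
    [BorelSpace α] [SecondCountableTopology α] [CompleteSpace α] (E : Observable N α)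
    {T : α → ModeSpace N →L[ℂ] ModeSpace N}
    (hT : ∀ p ψ, ⟪ψ, T p ψ⟫_ℂ = charFun (E.diagMeasure ψ) p)
    {ρ₁ ρ₂ : ModeSpace N →L[ℂ] ModeSpace N} (h₁ : IsState ρ₁) (h₂ : IsState ρ₂) :
    (∀ X, MeasurableSet X → opTrace (ρ₁ * E.eff X) = opTrace (ρ₂ * E.eff X)) ↔
      ∀ p, opTrace (ρ₁ * T p) = opTrace (ρ₂ * T p) := by
  obtain ⟨μ₁, hf₁, hμ₁, hc₁⟩ := E.exists_outcome_measure h₁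
  obtain ⟨μ₂, hf₂, hμ₂, hc₂⟩ := E.exists_outcome_measure h₂
  constructor
  · intro h p
    have hμ : μ₁ = μ₂ := by
      ext X hX
      have := h X hX
      rw [hμ₁ X hX, hμ₂ X hX, Complex.ofReal_inj] at this
      exact (measureReal_eq_measureReal_iff).1 this
    rw [← hc₁ p (T p) (hT p), ← hc₂ p (T p) (hT p), hμ]
  · intro h X hX
    have hμ : μ₁ = μ₂ := Measure.ext_of_charFun <| by
      ext p
      rw [hc₁ p (T p) (hT p), hc₂ p (T p) (hT p), h p]
    rw [hμ₁ X hX, hμ₂ X hX, hμ]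

end Outcome

/-! ### Probability measures whose characteristic functions differ only locally. -/

section Perturbation

theorem charFun_smul_measure {V : Type*} [NormedAddCommGroup V] [InnerProductSpace ℝ V]
    [MeasurableSpace V] (k : ENNReal) (μ : Measure V) (t : V) :
    charFun (k • μ) t = k.toReal * charFun μ t := by
  rw [charFun_apply, integral_smul_measure, Complex.real_smul, charFun_apply]

variable {V : Type*} [NormedAddCommGroup V] [InnerProductSpace ℝ V] [FiniteDimensional ℝ V]
  [MeasurableSpace V] [BorelSpace V]

open FourierTransform SchwartzMap
open scoped ContDiff

/-- There is an integrable real function with nonnegative characteristic integral that does not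
vanish at `u` and is supported in a given neighborhood of `{u, -u}`. -/
theorem exists_integrable_charIntegral {U : Set V} (hU : IsOpen U) {u : V} (hu : u ∈ U) :
    ∃ c : V → ℝ, Integrable c ∧ ∫ z, Complex.exp (⟪z, u⟫_ℝ * Complex.I) * c z ≠ 0 ∧
      ∀ t, t ∉ U → -t ∉ U → ∫ z, Complex.exp (⟪z, t⟫_ℝ * Complex.I) * c z = 0 := by
  -- The factor converts between the exponents of `charFun` and of `𝓕`; the bump function lives on
  -- the rescaled set.
  set r : ℝ := (2 * Real.pi)⁻¹ with hr
  have hr0 : (2 * Real.pi) * r = 1 := mul_inv_cancel₀ Real.two_pi_pos.ne'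
  have hU' : IsOpen ((fun v : V => (2 * Real.pi) • v) ⁻¹' U) := hU.preimage (by fun_prop)
  have hu' : (fun v : V => (2 * Real.pi) • v) ⁻¹' U ∈ nhds (r • u) :=
    hU'.mem_nhds (by simpa [smul_smul, hr0] using hu)
  obtain ⟨b, hbsupp, hbc, hb, hbr, hb1⟩ := exists_contDiff_tsupport_subset (n := ⊤) hu'
  have hbs' : HasCompactSupport fun x => (b x : ℂ) := hbc.comp_left Complex.ofReal_zero
  have hb' : ContDiff ℝ ∞ fun x => (b x : ℂ) := Complex.ofRealCLM.contDiff.comp hb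
  set s : 𝓢(V, ℂ) := hbs'.toSchwartzMap hb' with hs
  have hsb : ∀ x, s x = b x := fun x => rfl
  have hint := (𝓕 s).integrable (μ := volume)
  have hF : ∀ t, ∫ z, Complex.exp (⟪z, t⟫_ℝ * Complex.I) * 𝓕 s z = b (r • t) := fun t => by
    have h : 𝓕⁻ (𝓕 s) (r • t) = s (r • t) := by rw [FourierTransform.fourierInv_fourier_eq]
    rw [SchwartzMap.fourierInv_coe, Real.fourierInv_eq'] at h
    rw [← hsb, ← h]
    refine integral_congr_ae (Filter.Eventually.of_forall fun z => ?_)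
    simp only [smul_eq_mul, inner_smul_right]
    rw [← mul_assoc, hr0, one_mul]
  have hexp : ∀ t z : V, starRingEnd ℂ (Complex.exp (⟪z, t⟫_ℝ * Complex.I)) =
      Complex.exp (⟪z, -t⟫_ℝ * Complex.I) := fun t z => by
    rw [← Complex.exp_conj, map_mul, Complex.conj_ofReal, Complex.conj_I, inner_neg_right]
    push_cast
    ring_nf
  have hFc : ∀ t, ∫ z, Complex.exp (⟪z, t⟫_ℝ * Complex.I) * starRingEnd ℂ (𝓕 s z) =
      b (r • -t) := fun t => by
    rw [← Complex.conj_ofReal (b (r • -t)), ← hF (-t), ← integral_conj]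
    refine integral_congr_ae (Filter.Eventually.of_forall fun z => ?_)
    simp only [map_mul, hexp, neg_neg]
  have hi : ∀ (t : V) (f : V → ℂ), Integrable f →
      Integrable fun z => Complex.exp (⟪z, t⟫_ℝ * Complex.I) * f z := fun t f hf =>
    hf.bdd_mul (c := 1) (Continuous.aestronglyMeasurable (by fun_prop))
      (Filter.Eventually.of_forall fun z => by rw [Complex.norm_exp_ofReal_mul_I])
  have hconj : Integrable fun z => starRingEnd ℂ (𝓕 s z) := 
    Complex.conjLIE.toContinuousLinearEquiv.toContinuousLinearMap.integrable_comp hint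
  -- A density must be real. Taking twice the real part symmetrizes the bump, which is why `-t` has
  -- to avoid `U` too; nothing cancels at `u`, since `b` is nonnegative.
  have hc : ∀ t, ∫ z, Complex.exp (⟪z, t⟫_ℝ * Complex.I) * ((2 * (𝓕 s z).re : ℝ) : ℂ) =
      ((b (r • t) + b (r • -t) : ℝ) : ℂ) := fun t => by
    rw [Complex.ofReal_add, ← hF t, ← hFc t, ← integral_add (hi t _ hint) (hi t _ hconj)]
    refine integral_congr_ae (Filter.Eventually.of_forall fun z => ?_)
    simp only [← mul_add, Complex.add_conj]
  refine ⟨fun z => 2 * (𝓕 s z).re, hint.re.const_mul 2, ?_, fun t ht ht' => ?_⟩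
  · rw [hc, hb1, Ne, Complex.ofReal_eq_zero]
    have : 0 ≤ b (r • -u) := (hbr ⟨_, rfl⟩).1
    positivity
  · have hz : ∀ t, t ∉ U → b (r • t) = 0 := fun t ht => by
      refine image_eq_zero_of_notMem_tsupport fun h => ht ?_
      simpa [smul_smul, hr0] using hbsupp h
    rw [hc, hz t ht, hz _ ht', add_zero, Complex.ofReal_zero]

theorem charFun_withDensity_ofReal {c : V → ℝ} (hc : Integrable c) (t : V) :
    charFun (volume.withDensity fun z => ENNReal.ofReal (c z)) t =
      ∫ z, Complex.exp (⟪z, t⟫_ℝ * Complex.I) * (max (c z) 0 : ℝ) := by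
  rw [charFun_apply, integral_withDensity_eq_integral_toReal_smul₀
    hc.aestronglyMeasurable.aemeasurable.ennreal_ofReal
    (Filter.Eventually.of_forall fun z => ENNReal.ofReal_lt_top)]
  refine integral_congr_ae (Filter.Eventually.of_forall fun z => ?_)
  simp only [ENNReal.toReal_ofReal', Complex.real_smul, mul_comm]

/-- Two probability measures whose characteristic functions differ at `u`, but only near
`{u, -u}`. -/
theorem exists_probabilityMeasure_charFun_eq_off {U : Set V} (hU : IsOpen U) {u : V} (hu : u ∈ U)
    (hu0 : u ≠ 0) :
    ∃ μ₁ μ₂ : Measure V, IsProbabilityMeasure μ₁ ∧ IsProbabilityMeasure μ₂ ∧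
      charFun μ₁ u ≠ charFun μ₂ u ∧ ∀ t, t ∉ U → -t ∉ U → charFun μ₁ t = charFun μ₂ t := by
  -- Removing `0` makes `c` have integral zero, so its positive and negative parts have equal mass
  -- and can be normalized by the same constant.
  obtain ⟨c, hc, hcu, hct⟩ := exists_integrable_charIntegral (U := U \ {0})
    (hU.sdiff isClosed_singleton) (u := u) ⟨hu, hu0⟩
  set ν₁ : Measure V := volume.withDensity fun z => ENNReal.ofReal (c z)
  set ν₂ : Measure V := volume.withDensity fun z => ENNReal.ofReal (-c z)
  have hf₁ : IsFiniteMeasure ν₁ := isFiniteMeasure_withDensity_ofReal hc.2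
  have hf₂ : IsFiniteMeasure ν₂ := isFiniteMeasure_withDensity_ofReal hc.neg.2
  have hi : ∀ (t : V) (f : V → ℝ), Integrable f →
      Integrable fun z => Complex.exp (⟪z, t⟫_ℝ * Complex.I) * f z := fun t f hf =>
    hf.ofReal.bdd_mul (c := 1) (Continuous.aestronglyMeasurable (by fun_prop))
      (Filter.Eventually.of_forall fun z => by rw [Complex.norm_exp_ofReal_mul_I])
  have hdiff : ∀ t, charFun ν₁ t - charFun ν₂ t =
      ∫ z, Complex.exp (⟪z, t⟫_ℝ * Complex.I) * c z := fun t => by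
    rw [charFun_withDensity_ofReal hc, charFun_withDensity_ofReal (c := fun z => -c z) hc.neg,
      ← integral_sub (hi t _ hc.pos_part) (hi t _ hc.neg_part)]
    refine integral_congr_ae (Filter.Eventually.of_forall fun z => ?_)
    simp only [← mul_sub, ← Complex.ofReal_sub]
    congr 2
    rcases le_total 0 (c z) with h | h
    · simp [h]
    · simp [h]
  have huniv : ν₁ Set.univ = ν₂ Set.univ := by
    have h0 := hdiff 0
    rw [hct 0 (by simp) (by simp), sub_eq_zero, charFun_zero, charFun_zero,
      Complex.ofReal_inj] at h0
    exact (measureReal_eq_measureReal_iff).1 h0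
  have hne₁ : ν₁ ≠ 0 := by
    intro h
    have h2 : ν₂ = 0 := by rw [← Measure.measure_univ_eq_zero, ← huniv, h]; rfl
    apply hcu
    rw [← hdiff, h, h2, sub_self]
  have hne₂ : ν₂ ≠ 0 := by
    intro h
    exact hne₁ (by rw [← Measure.measure_univ_eq_zero, huniv, h]; rfl)
  have : NeZero ν₁ := ⟨hne₁⟩
  have : NeZero ν₂ := ⟨hne₂⟩
  refine ⟨(ν₁ Set.univ)⁻¹ • ν₁, (ν₂ Set.univ)⁻¹ • ν₂, inferInstance, inferInstance, ?_, ?_⟩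
  · rw [charFun_smul_measure, charFun_smul_measure, huniv]
    intro h
    have hk : (((ν₂ Set.univ)⁻¹.toReal : ℝ) : ℂ) ≠ 0 := by
      rw [Ne, Complex.ofReal_eq_zero, ENNReal.toReal_eq_zero_iff]
      simp [hne₂]
    apply hcu
    rw [← hdiff, mul_left_cancel₀ hk h, sub_self]
  · intro t ht ht'
    rw [charFun_smul_measure, charFun_smul_measure, huniv]
    congr 1
    rw [← sub_eq_zero, hdiff]
    exact hct t (fun h => ht h.1) (fun h => ht' h.1)

end Perturbation

/-! ### Mixtures of displaced pure states. -/

section Mixture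

variable {N : ℕ}

theorem weyl_conj_apply (x z : PhaseSpace N) (ψ : ModeSpace N) :
    ⟪weyl z ψ, weyl x (weyl z ψ)⟫_ℂ =
      Complex.exp (⟪z, phaseRot x⟫_ℝ * Complex.I) * ⟪ψ, weyl x ψ⟫_ℂ := by
  rw [inner_weyl_left]
  have h := weyl_weyl_weyl_neg (-z) x ψ
  rw [neg_neg] at h
  rw [h, inner_smul_right, mul_comm Complex.I, real_inner_comm, inner_phaseRot_left]
  congr 4
  simp only [symp, phasePos_neg, phaseMom_neg, inner_neg_left, inner_neg_right]
  ring

/-- The mixture `∫ |W(z) g⟩⟨W(z) g| μ(dz)`. -/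
def weylMixture (g : ModeSpace N) (μ : Measure (PhaseSpace N)) : ModeSpace N →L[ℂ] ModeSpace N :=
  ∫ z, InnerProductSpace.rankOne ℂ (weyl z g) (weyl z g) ∂μ

variable (g : ModeSpace N) (μ : Measure (PhaseSpace N)) [IsFiniteMeasure μ]

theorem integrable_rankOne_weyl :
    Integrable (fun z => InnerProductSpace.rankOne ℂ (weyl z g) (weyl z g)) μ := by
  have hc := continuous_weyl_apply g
  have hcont : Continuous fun z => InnerProductSpace.rankOne ℂ (weyl z g) (weyl z g) := by
    have h1 : Continuous fun z => innerSL ℂ (weyl z g) := (innerSL ℂ).continuous.comp hc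
    exact ((ContinuousLinearMap.smulRightL ℂ (ModeSpace N) (ModeSpace N)).continuous.comp
      h1).clm_apply hc
  refine Integrable.of_bound (C := ‖g‖ * ‖g‖) hcont.aestronglyMeasurable
    (Filter.Eventually.of_forall fun z => ?_)
  rw [InnerProductSpace.norm_rankOne, norm_weyl_apply]

theorem inner_weylMixture (φ ψ : ModeSpace N) :
    ⟪φ, weylMixture g μ ψ⟫_ℂ = ∫ z, ⟪φ, weyl z g⟫_ℂ * ⟪weyl z g, ψ⟫_ℂ ∂μ := by
  have hi := integrable_rankOne_weyl g μ
  rw [weylMixture, ContinuousLinearMap.integral_apply hi,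
    ← integral_inner (hi.apply_continuousLinearMap ψ)]
  refine integral_congr_ae (Filter.Eventually.of_forall fun z => ?_)
  simp only [InnerProductSpace.rankOne_apply, inner_smul_right, mul_comm]

/-- The trace series is integrated term by term. Each term is dominated, by the inequality of the
means, by Parseval summands of `W(z) g` and `B* W(z) g`, whose sums are bounded in `z`. -/
theorem opTrace_weylMixture_mul (B : ModeSpace N →L[ℂ] ModeSpace N) :
    opTrace (weylMixture g μ * B) = ∫ z, ⟪weyl z g, B (weyl z g)⟫_ℂ ∂μ := by
  set b := traceBasis (ModeSpace N)
  have hc := continuous_weyl_apply g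
  rw [opTrace_eq_tsum_traceBasis]
  simp only [mul_apply_eq_comp, inner_weylMixture]
  have hP : ∀ z, HasSum (fun i => ⟪b i, weyl z g⟫_ℂ * ⟪weyl z g, B (b i)⟫_ℂ)
      ⟪weyl z g, B (weyl z g)⟫_ℂ := fun z => by
    have h := b.hasSum_inner_mul_inner (ContinuousLinearMap.adjoint B (weyl z g)) (weyl z g)
    simp only [ContinuousLinearMap.adjoint_inner_left] at h
    simpa only [mul_comm ⟪b _, weyl z g⟫_ℂ] using h
  refine HasSum.tsum_eq ?_
  refine hasSum_integral_of_dominated_convergence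
    (bound := fun i z => 1 / 2 * (‖⟪b i, weyl z g⟫_ℂ‖ ^ 2 +
      ‖⟪b i, ContinuousLinearMap.adjoint B (weyl z g)⟫_ℂ‖ ^ 2))
    (fun i => ?_) (fun i => ?_) ?_ ?_ (Filter.Eventually.of_forall hP)
  · exact Continuous.aestronglyMeasurable (by fun_prop)
  · refine Filter.Eventually.of_forall fun z => ?_
    rw [norm_mul, ← ContinuousLinearMap.adjoint_inner_left B, norm_inner_symm _ (b i)]
    nlinarith [sq_nonneg (‖⟪b i, weyl z g⟫_ℂ‖ -
      ‖⟪b i, ContinuousLinearMap.adjoint B (weyl z g)⟫_ℂ‖)]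
  · exact Filter.Eventually.of_forall fun z =>
      ((b.hasSum_sq_norm_inner _).summable.add (b.hasSum_sq_norm_inner _).summable).mul_left _
  · have h : ∀ z, ∑' i, 1 / 2 * (‖⟪b i, weyl z g⟫_ℂ‖ ^ 2 +
        ‖⟪b i, ContinuousLinearMap.adjoint B (weyl z g)⟫_ℂ‖ ^ 2) =
        1 / 2 * (‖g‖ ^ 2 + ‖ContinuousLinearMap.adjoint B (weyl z g)‖ ^ 2) := fun z => by
      rw [← norm_weyl_apply z g]
      exact (((b.hasSum_sq_norm_inner _).add (b.hasSum_sq_norm_inner _)).mul_left _).tsum_eq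
    simp only [h]
    refine Integrable.of_bound
      (C := 1 / 2 * (‖g‖ ^ 2 + (‖ContinuousLinearMap.adjoint B‖ * ‖g‖) ^ 2))
      (Continuous.aestronglyMeasurable (by fun_prop)) (Filter.Eventually.of_forall fun z => ?_)
    rw [Real.norm_of_nonneg (by positivity)]
    gcongr
    rw [← norm_weyl_apply z g]
    exact ContinuousLinearMap.le_opNorm _ _

theorem isState_weylMixture {g : ModeSpace N} (hg : ‖g‖ = 1) (μ : Measure (PhaseSpace N))
    [IsProbabilityMeasure μ] : IsState (weylMixture g μ) := by
  refine ⟨?_, ?_⟩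
  · rw [ContinuousLinearMap.isPositive_iff_complex]
    intro ψ
    have h : ⟪weylMixture g μ ψ, ψ⟫_ℂ = ((∫ z, ‖⟪weyl z g, ψ⟫_ℂ‖ ^ 2 ∂μ : ℝ) : ℂ) := by
      rw [← inner_conj_symm, inner_weylMixture, ← integral_complex_ofReal, ← integral_conj]
      refine integral_congr_ae (Filter.Eventually.of_forall fun z => ?_)
      simp only [map_mul, inner_conj_symm]
      rw [mul_comm, ← inner_conj_symm ψ, ← Complex.normSq_eq_conj_mul_self,
        Complex.normSq_eq_norm_sq]
    rw [h]
    exact ⟨by simp, by simpa using integral_nonneg fun z => sq_nonneg _⟩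
  · have h := opTrace_weylMixture_mul g μ 1
    rw [mul_one] at h
    rw [h]
    simp only [one_apply_eq_self, inner_self_eq_norm_sq_to_K, norm_weyl_apply, hg]
    simp

/-- Displacing by `z` multiplies the matrix element of `W(x)` by a character of `z`, so averaging
over `μ` produces the characteristic function of `μ`. -/
theorem weylTransform_weylMixture (x : PhaseSpace N) :
    weylTransform (weylMixture g μ) x = charFun μ (phaseRot x) * ⟪g, weyl x g⟫_ℂ := by
  rw [weylTransform, opTrace_weylMixture_mul, charFun_apply, ← integral_mul_const]
  simp only [weyl_conj_apply]

end Mixture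

/-! ### The density criterion for informational completeness. -/

section Completeness

variable {N : ℕ}

instance : Nontrivial (ModeSpace N) := by
  have hv : (volume : Measure (ConfigSpace N)) (Metric.ball 0 1) ≠ ⊤ :=
    measure_ball_lt_top.ne
  refine ⟨indicatorConstLp 2 measurableSet_ball hv (1 : ℂ), 0, fun h => ?_⟩
  have hn := norm_indicatorConstLp (p := 2) (hs := measurableSet_ball) (hμs := hv) (c := (1 : ℂ))
    (by norm_num) (by norm_num)
  rw [h, norm_zero, norm_one, one_mul, eq_comm, Real.rpow_eq_zero (by positivity) (by norm_num),
    measureReal_eq_zero_iff hv] at hn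
  exact (Metric.measure_ball_pos volume (0 : ConfigSpace N) one_pos).ne' hn

/-- On a complex Hilbert space an operator with vanishing quadratic form is zero, whereas `W(x)` is
an isometry of a nonzero space. -/
theorem exists_inner_weyl_ne_zero (x : PhaseSpace N) :
    ∃ ψ : ModeSpace N, ‖ψ‖ = 1 ∧ ⟪ψ, weyl x ψ⟫_ℂ ≠ 0 := by
  have h : ∃ ψ : ModeSpace N, ⟪ψ, weyl x ψ⟫_ℂ ≠ 0 := by
    by_contra! h
    have h0 := (inner_map_self_eq_zero (weyl x : ModeSpace N →ₗ[ℂ] ModeSpace N)).1 fun ψ => by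
      rw [← inner_conj_symm]
      simp [h ψ]
    obtain ⟨ψ, hψ⟩ := exists_ne (0 : ModeSpace N)
    apply hψ
    rw [← norm_eq_zero, ← norm_weyl_apply x, norm_eq_zero]
    exact congrArg (fun T => T ψ) h0
  obtain ⟨ψ, hψ⟩ := h
  have hψ0 : ψ ≠ 0 := fun h0 => hψ (by simp [h0])
  refine ⟨((‖ψ‖⁻¹ : ℝ) : ℂ) • ψ, ?_, ?_⟩
  · simp [norm_smul, hψ0]
  · rw [map_smul, inner_smul_left, inner_smul_right]
    simp [hψ0, hψ]

/-- A family of observables whose characteristic functions are multiples of Weyl operators is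
informationally complete if and only if the reached phase space points are dense. -/
theorem informationallyComplete_iff_dense (hN : 1 ≤ N) {I : Type*} {α : I → Type*}
    [∀ j, MeasurableSpace (α j)] [∀ j, NormedAddCommGroup (α j)]
    [∀ j, InnerProductSpace ℝ (α j)] [∀ j, BorelSpace (α j)]
    [∀ j, SecondCountableTopology (α j)] [∀ j, CompleteSpace (α j)]
    {E : (j : I) → Observable N (α j)} {A : (j : I) → α j → PhaseSpace N}
    (hA : ∀ j p, A j (-p) = -A j p) {f : (j : I) → α j → ℂ}
    (hE : ∀ j p ψ, ⟪ψ, (f j p • weyl (A j p)) ψ⟫_ℂ = charFun ((E j).diagMeasure ψ) p) :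
    InformationallyComplete E ↔ Dense (⋃ j, {y | ∃ p, f j p ≠ 0 ∧ A j p = y}) := by
  have hstat : ∀ {ρ₁ ρ₂ : ModeSpace N →L[ℂ] ModeSpace N}, IsState ρ₁ → IsState ρ₂ →
      ((∀ j, ∀ X, MeasurableSet X →
        opTrace (ρ₁ * (E j).eff X) = opTrace (ρ₂ * (E j).eff X)) ↔
      ∀ y ∈ ⋃ j, {y | ∃ p, f j p ≠ 0 ∧ A j p = y}, weylTransform ρ₁ y = weylTransform ρ₂ y) := by
    intro ρ₁ ρ₂ h₁ h₂
    simp only [fun j => (E j).forall_opTrace_eff_eq_iff (hE j) h₁ h₂, opTrace_mul_smul,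
      Set.mem_iUnion, Set.mem_ofPred_eq, weylTransform]
    constructor
    · rintro h y ⟨j, p, hp, rfl⟩
      exact mul_left_cancel₀ hp (h j p)
    · intro h j p
      by_cases hp : f j p = 0
      · rw [hp, zero_mul, zero_mul]
      · rw [h _ ⟨j, p, hp, rfl⟩]
  constructor
  · intro hIC
    by_contra hd
    set Y := ⋃ j, {y | ∃ p, f j p ≠ 0 ∧ A j p = y} with hY
    -- Characteristic functions of measures satisfy `χ(-p) = conj χ(p)`, so `f(-p) = 0` would make
    -- the quadratic form of `f(p) W(A p)` vanish.
    have hneg : ∀ y ∈ Y, -y ∈ Y := by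
      intro y hy
      simp only [hY, Set.mem_iUnion, Set.mem_ofPred_eq] at hy ⊢
      obtain ⟨j, p, hp, rfl⟩ := hy
      refine ⟨j, -p, fun h0 => ?_, hA j p⟩
      obtain ⟨ψ, -, hψ⟩ := exists_inner_weyl_ne_zero (A j p)
      have h := hE j (-p) ψ
      rw [charFun_neg, ← hE j p ψ, h0, zero_smul, smul_apply, inner_smul_right, zero_apply,
        inner_zero_right, eq_comm, map_eq_zero, mul_eq_zero] at h
      exact h.elim hp hψ
    have hUo : IsOpen (closure Y)ᶜ := isClosed_closure.isOpen_compl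
    have hUne : ((closure Y)ᶜ).Nonempty := by
      rw [Set.nonempty_compl]
      exact fun h => hd (dense_iff_closure_eq.2 h)
    have : Nonempty (Fin N) := ⟨⟨0, hN⟩⟩
    -- For `N ≥ 1` phase space has no isolated points, so `u` can avoid the origin, where all states
    -- have transform `1`.
    obtain ⟨u, hu, hu0⟩ := (dense_compl_singleton (0 : PhaseSpace N)).inter_open_nonempty _ hUo hUne
    have hrot : ∀ x : PhaseSpace N, -phaseRot (phaseRot x) = x := fun x => by
      rw [phaseRot_phaseRot, neg_neg]
    -- The transform of a mixture at `x` involves `charFun μ` at `J x`, so the neighborhood is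
    -- carried over by `J`, whose inverse is `-J`.
    obtain ⟨μ₁, μ₂, hp₁, hp₂, hne, heq⟩ := exists_probabilityMeasure_charFun_eq_off
      (U := (fun t => -phaseRot t) ⁻¹' (closure Y)ᶜ) (hUo.preimage continuous_phaseRot.neg)
      (u := phaseRot u) (by rwa [Set.mem_preimage, hrot]) (fun h => hu0 (by
        rw [Set.mem_singleton_iff, ← hrot u, h, map_zero, neg_zero]))
    obtain ⟨g, hg, hgu⟩ := exists_inner_weyl_ne_zero u
    have h₁ := isState_weylMixture hg μ₁
    have h₂ := isState_weylMixture hg μ₂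
    have hρ := hIC _ _ h₁ h₂ ((hstat h₁ h₂).2 fun y hy => by
      rw [weylTransform_weylMixture, weylTransform_weylMixture, heq]
      · rw [Set.mem_preimage, hrot]
        exact fun h => h (subset_closure hy)
      · rw [Set.mem_preimage, map_neg, neg_neg, phaseRot_phaseRot]
        exact fun h => h (subset_closure (hneg y hy)))
    have hW := congrArg (fun ρ => weylTransform ρ u) hρ
    simp only [weylTransform_weylMixture] at hW
    exact hne (mul_right_cancel₀ hgu hW)
  · intro hd ρ₁ ρ₂ h₁ h₂ h
    refine h₁.eq_of_weylTransform_eq h₂ ?_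
    exact h₁.continuous_weylTransform.ext_on hd h₂.continuous_weylTransform ((hstat h₁ h₂).1 h)

end Completeness

/-! ### The covariant observables `E_σ`. -/

section Covariant

variable {N : ℕ}

/-- The matrix element `⟪φ, W(x) σ W(x)* ψ⟫`. -/
def weylKernel (σ : ModeSpace N →L[ℂ] ModeSpace N) (φ ψ : ModeSpace N) (x : PhaseSpace N) : ℂ :=
  ⟪φ, (weyl x * σ * ContinuousLinearMap.adjoint (weyl x)) ψ⟫_ℂ

theorem weylKernel_eq (σ : ModeSpace N →L[ℂ] ModeSpace N) (φ ψ : ModeSpace N) (x : PhaseSpace N) :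
    weylKernel σ φ ψ x = ⟪weyl (-x) φ, σ (weyl (-x) ψ)⟫_ℂ := by
  rw [weylKernel, adjoint_weyl, inner_weyl_left, neg_neg]
  rfl

theorem continuous_weylKernel (σ : ModeSpace N →L[ℂ] ModeSpace N) (φ ψ : ModeSpace N) :
    Continuous (weylKernel σ φ ψ) := by
  have h : ∀ χ : ModeSpace N, Continuous fun x : PhaseSpace N => weyl (-x) χ := fun χ =>
    (continuous_weyl_apply χ).comp continuous_neg
  have heq : weylKernel σ φ ψ = fun x => ⟪weyl (-x) φ, σ (weyl (-x) ψ)⟫_ℂ :=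
    funext (weylKernel_eq σ φ ψ)
  rw [heq]
  exact (h φ).inner (σ.continuous.comp (h ψ))

theorem IsEnsemble.hasSum_weylKernel {ι : Type*} {σ : ModeSpace N →L[ℂ] ModeSpace N}
    {v : ι → ModeSpace N} (hv : IsEnsemble σ v) (φ ψ : ModeSpace N) (x : PhaseSpace N) :
    HasSum (fun i => ⟪weyl x (v i), ψ⟫_ℂ * ⟪φ, weyl x (v i)⟫_ℂ) (weylKernel σ φ ψ x) := by
  rw [weylKernel_eq]
  convert hv.hasSum_inner (weyl (-x) φ) (weyl (-x) ψ) using 2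
  rw [inner_weyl_left, inner_weyl_left, neg_neg, mul_comm]

theorem integrable_tsum_of_summable_integral_norm {ι α : Type*} [Countable ι] [MeasurableSpace α]
    {μ : Measure α} {F : ι → α → ℂ} {f : α → ℂ} (hF : ∀ i, Integrable (F i) μ)
    (hs : Summable fun i => ∫ a, ‖F i a‖ ∂μ) (hf : AEStronglyMeasurable f μ)
    (h : ∀ a, HasSum (fun i => F i a) (f a)) : Integrable f μ := by
  refine ⟨hf, ?_⟩
  calc ∫⁻ a, ‖f a‖ₑ ∂μ ≤ ∫⁻ a, ∑' i, ‖F i a‖ₑ ∂μ :=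
        lintegral_mono fun a => by
          rw [← (h a).tsum_eq]
          exact enorm_tsum_le_tsum_enorm
    _ = ∑' i, ∫⁻ a, ‖F i a‖ₑ ∂μ := lintegral_tsum fun i => (hF i).aestronglyMeasurable.enorm
    _ = ∑' i, ENNReal.ofReal (∫ a, ‖F i a‖ ∂μ) := by
        simp only [ofReal_integral_norm_eq_lintegral_enorm (hF _)]
    _ = ENNReal.ofReal (∑' i, ∫ a, ‖F i a‖ ∂μ) :=
        (ENNReal.ofReal_tsum_of_nonneg (fun i => integral_nonneg fun a => norm_nonneg _) hs).symm
    _ < ⊤ := ENNReal.ofReal_lt_top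

variable {σ : ModeSpace N →L[ℂ] ModeSpace N}

theorem IsEnsemble.summable_integral_norm_weyl {ι : Type*} {v : ι → ModeSpace N}
    (hv : IsEnsemble σ v) (φ ψ : ModeSpace N) :
    Summable fun i => ∫ x, ‖⟪weyl x (v i), ψ⟫_ℂ * ⟪φ, weyl x (v i)⟫_ℂ‖ := by
  refine Summable.of_nonneg_of_le (fun i => integral_nonneg fun x => norm_nonneg _)
    (fun i => integral_norm_inner_weyl_mul_le _ _ _ _)
    (((hv.hasSum_sq_norm.summable.mul_left (‖ψ‖ * ‖φ‖)).mul_left ((2 * Real.pi) ^ N)).congr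
      fun i => ?_)
  ring

theorem IsState.integrable_weylKernel (hσ : IsState σ) (φ ψ : ModeSpace N) :
    Integrable (weylKernel σ φ ψ) := by
  obtain ⟨v, hv⟩ := hσ.exists_isEnsemble
  exact integrable_tsum_of_summable_integral_norm
    (fun i => integrable_inner_weyl_mul _ _ _ _) (hv.summable_integral_norm_weyl φ ψ)
    (continuous_weylKernel σ φ ψ).aestronglyMeasurable (hv.hasSum_weylKernel φ ψ)

/-- The symplectic Fourier transform of `x ↦ ⟪φ, W(x) σ W(x)* ψ⟫`. -/
theorem IsState.integral_exp_mul_weylKernel (hσ : IsState σ) (φ ψ : ModeSpace N)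
    (u : PhaseSpace N) :
    ∫ x, Complex.exp (Complex.I * symp u x) * weylKernel σ φ ψ x =
      ((2 * Real.pi) ^ N : ℝ) * (weylTransform σ (-u) * ⟪φ, weyl u ψ⟫_ℂ) := by
  obtain ⟨v, hv⟩ := hσ.exists_isEnsemble
  -- The character is absorbed through `W(u) W(x) W(-u) = e^{i symp u x} W(x)`, so the orthogonality
  -- relations apply with shifted vectors.
  have hF : ∀ i (x : PhaseSpace N), Complex.exp (Complex.I * symp u x) *
      (⟪weyl x (v i), ψ⟫_ℂ * ⟪φ, weyl x (v i)⟫_ℂ) =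
      ⟪weyl x (v i), ψ⟫_ℂ * ⟪weyl (-u) φ, weyl x (weyl (-u) (v i))⟫_ℂ := fun i x => by
    rw [inner_weyl_left (-u), neg_neg, weyl_weyl_weyl_neg, inner_smul_right]
    ring
  have hsum := hasSum_integral_of_summable_integral_norm (μ := (volume : Measure (PhaseSpace N)))
    (F := fun i x => Complex.exp (Complex.I * symp u x) *
      (⟪weyl x (v i), ψ⟫_ℂ * ⟪φ, weyl x (v i)⟫_ℂ))
    (fun i => by
      simp only [hF]
      exact integrable_inner_weyl_mul _ _ _ _)
    (by
      simp only [norm_mul (Complex.exp _), mul_comm Complex.I, Complex.norm_exp_ofReal_mul_I,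
        one_mul]
      exact hv.summable_integral_norm_weyl φ ψ)
  simp only [((hv.hasSum_weylKernel φ ψ _).mul_left _).tsum_eq] at hsum
  refine hsum.unique ?_
  simp only [hF, integral_inner_weyl_mul_inner_weyl]
  have h := (hv.hasSum_opTrace (weyl (-u))).mul_left
    (((2 * Real.pi) ^ N : ℝ) * ⟪φ, weyl u ψ⟫_ℂ)
  rw [inner_weyl_left, neg_neg]
  rw [mul_comm (weylTransform σ (-u)), ← mul_assoc]
  exact h

theorem IsState.weylTransform_zero (hσ : IsState σ) : weylTransform σ 0 = 1 := by
  rw [weylTransform, weyl_zero, mul_one, hσ.trace_eq_one]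

theorem IsState.integral_weylKernel (hσ : IsState σ) (φ ψ : ModeSpace N) :
    ∫ x, weylKernel σ φ ψ x = ((2 * Real.pi) ^ N : ℝ) * ⟪φ, ψ⟫_ℂ := by
  have h := hσ.integral_exp_mul_weylKernel φ ψ 0
  simpa [symp, weyl_zero, hσ.weylTransform_zero] using h

section SquareRoot

variable {S : ModeSpace N →L[ℂ] ModeSpace N}

theorem weylKernel_eq_inner_sqrt (hS : ∀ φ ψ, ⟪S φ, S ψ⟫_ℂ = ⟪φ, σ ψ⟫_ℂ) (φ ψ : ModeSpace N)
    (x : PhaseSpace N) : weylKernel σ φ ψ x = ⟪S (weyl (-x) φ), S (weyl (-x) ψ)⟫_ℂ := by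
  rw [weylKernel_eq, hS]

theorem weylKernel_self (hS : ∀ φ ψ, ⟪S φ, S ψ⟫_ℂ = ⟪φ, σ ψ⟫_ℂ) (ψ : ModeSpace N)
    (x : PhaseSpace N) : weylKernel σ ψ ψ x = ((‖S (weyl (-x) ψ)‖ ^ 2 : ℝ) : ℂ) := by
  rw [weylKernel_eq_inner_sqrt hS, inner_self_eq_ofReal_norm_sq]

theorem memLp_sqrt_weyl (hσ : IsState σ) (hS : ∀ φ ψ, ⟪S φ, S ψ⟫_ℂ = ⟪φ, σ ψ⟫_ℂ)
    (ψ : ModeSpace N) : MemLp (fun x : PhaseSpace N => S (weyl (-x) ψ)) 2 volume := by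
  have hc : Continuous fun x : PhaseSpace N => S (weyl (-x) ψ) :=
    S.continuous.comp ((continuous_weyl_apply ψ).comp continuous_neg)
  rw [memLp_two_iff_integrable_sq_norm hc.aestronglyMeasurable]
  have h := (hσ.integrable_weylKernel ψ ψ).re
  simpa only [weylKernel_self hS, RCLike.re_to_complex, Complex.ofReal_re] using h

theorem inner_toLp_sqrt_weyl (hσ : IsState σ) (hS : ∀ φ ψ, ⟪S φ, S ψ⟫_ℂ = ⟪φ, σ ψ⟫_ℂ)
    (X : Set (PhaseSpace N)) (φ ψ : ModeSpace N) :
    ⟪((memLp_sqrt_weyl hσ hS φ).restrict X).toLp _, ((memLp_sqrt_weyl hσ hS ψ).restrict X).toLp _⟫_ℂ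
      = ∫ x in X, weylKernel σ φ ψ x := by
  rw [L2.inner_def]
  refine integral_congr_ae ?_
  filter_upwards [((memLp_sqrt_weyl hσ hS φ).restrict X).coeFn_toLp,
    ((memLp_sqrt_weyl hσ hS ψ).restrict X).coeFn_toLp] with x h1 h2
  rw [h1, h2, weylKernel_eq_inner_sqrt hS]

/-- The map `ψ ↦ (x ↦ S W(x)* ψ)` into the square integrable functions on `X`. -/
def sqrtWeylMap (hσ : IsState σ) (hS : ∀ φ ψ, ⟪S φ, S ψ⟫_ℂ = ⟪φ, σ ψ⟫_ℂ)
    (X : Set (PhaseSpace N)) :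
    ModeSpace N →L[ℂ] Lp (ModeSpace N) 2 ((volume : Measure (PhaseSpace N)).restrict X) :=
  LinearMap.mkContinuous
    { toFun := fun ψ => ((memLp_sqrt_weyl hσ hS ψ).restrict X).toLp _
      map_add' := fun φ ψ => by
        rw [← MemLp.toLp_add]
        congr 1
        ext1 x
        simp only [map_add, Pi.add_apply]
      map_smul' := fun c ψ => by
        rw [RingHom.id_apply, ← MemLp.toLp_const_smul]
        congr 1
        ext1 x
        simp only [map_smul, Pi.smul_apply] }
    -- Over the whole phase space the squared norm of the image is exactly `(2π)^N ‖ψ‖²`;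
    -- restricting to `X` only decreases it.
    (√((2 * Real.pi) ^ N)) fun ψ => by
      have h := inner_toLp_sqrt_weyl hσ hS X ψ ψ
      have hu := hσ.integral_weylKernel ψ ψ
      have hi := (hσ.integrable_weylKernel ψ ψ).re
      simp only [weylKernel_self hS, RCLike.re_to_complex, Complex.ofReal_re] at h hu hi
      rw [integral_complex_ofReal, inner_self_eq_ofReal_norm_sq] at h
      rw [integral_complex_ofReal, inner_self_eq_ofReal_norm_sq] at hu
      have h' : ‖((memLp_sqrt_weyl hσ hS ψ).restrict X).toLp _‖ ^ 2 =
        ∫ x in X, ‖S (weyl (-x) ψ)‖ ^ 2 := Complex.ofReal_inj.1 h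
      have hu' : ∫ x, ‖S (weyl (-x) ψ)‖ ^ 2 = (2 * Real.pi) ^ N * ‖ψ‖ ^ 2 := by exact_mod_cast hu
      simp only [LinearMap.coe_mk, AddHom.coe_mk]
      rw [← pow_le_pow_iff_left₀ (norm_nonneg _) (by positivity) two_ne_zero, mul_pow,
        Real.sq_sqrt (by positivity), h', ← hu']
      exact setIntegral_le_integral hi (Filter.Eventually.of_forall fun x => sq_nonneg _)

theorem inner_sqrtWeylMap (hσ : IsState σ) (hS : ∀ φ ψ, ⟪S φ, S ψ⟫_ℂ = ⟪φ, σ ψ⟫_ℂ)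
    (X : Set (PhaseSpace N)) (φ ψ : ModeSpace N) :
    ⟪sqrtWeylMap hσ hS X φ, sqrtWeylMap hσ hS X ψ⟫_ℂ = ∫ x in X, weylKernel σ φ ψ x :=
  inner_toLp_sqrt_weyl hσ hS X φ ψ

end SquareRoot

/-- `E_σ` is an observable. -/
theorem IsState.exists_isGeneratedBy (hσ : IsState σ) :
    ∃ E : Observable N (PhaseSpace N), E.IsGeneratedBy σ := by
  obtain ⟨S, hSp, hSS⟩ := hσ.isPositive.exists_sqrt
  have hS : ∀ φ ψ, ⟪S φ, S ψ⟫_ℂ = ⟪φ, σ ψ⟫_ℂ := fun φ ψ => by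
    rw [hSp.inner_left_eq_inner_right, hSS]
  have hc : (((2 * Real.pi) ^ N : ℝ) : ℂ) ≠ 0 := by
    exact_mod_cast (pow_pos Real.two_pi_pos N).ne'
  -- Written as a multiple of `V* V`, the weak integral is automatically a bounded positive
  -- operator.
  let eff : Set (PhaseSpace N) → (ModeSpace N →L[ℂ] ModeSpace N) := fun X =>
    (((2 * Real.pi) ^ N : ℝ) : ℂ)⁻¹ •
      (ContinuousLinearMap.adjoint (sqrtWeylMap hσ hS X) ∘SL sqrtWeylMap hσ hS X)
  have heff : ∀ X φ ψ, ⟪φ, eff X ψ⟫_ℂ =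
      (((2 * Real.pi) ^ N : ℝ) : ℂ)⁻¹ * ∫ x in X, weylKernel σ φ ψ x := fun X φ ψ => by
    simp only [eff, smul_apply, inner_smul_right, ContinuousLinearMap.comp_apply]
    rw [ContinuousLinearMap.adjoint_inner_right, inner_sqrtWeylMap]
  refine ⟨⟨eff, fun X _ => ?_, ?_, fun X hX hd φ ψ => ?_⟩, fun X _ φ ψ => ⟨?_, heff X φ ψ⟩⟩
  · refine (ContinuousLinearMap.isPositive_adjoint_comp_self _).smul_of_nonneg ?_
    rw [← Complex.ofReal_inv]
    exact_mod_cast (inv_pos.2 (pow_pos Real.two_pi_pos N)).le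
  · ext1 ψ
    refine ext_inner_left ℂ fun φ => ?_
    rw [heff, setIntegral_univ, hσ.integral_weylKernel, inv_mul_cancel_left₀ hc,
      one_apply_eq_self]
  · simp only [heff]
    exact (hasSum_integral_iUnion hX hd (hσ.integrable_weylKernel φ ψ).integrableOn).mul_left _
  · exact (hσ.integrable_weylKernel φ ψ).integrableOn

/-- The phases from the Weyl relations occur once conjugated and once not, hence cancel; only the
shift remains, and covariance becomes a change of variables. -/
theorem weylKernel_weyl_neg (φ ψ : ModeSpace N) (x y : PhaseSpace N) :
    weylKernel σ (weyl (-x) φ) (weyl (-x) ψ) y = weylKernel σ φ ψ (y + x) := by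
  rw [weylKernel_eq, weylKernel_eq, weyl_weyl, weyl_weyl, map_smul, inner_smul_left,
    inner_smul_right, ← mul_assoc, ← Complex.exp_conj, ← Complex.exp_add, neg_add, map_mul, Complex.conj_I,
    Complex.conj_ofReal, neg_mul, neg_add_cancel, Complex.exp_zero, one_mul]

theorem Observable.IsGeneratedBy.isCovariant {E : Observable N (PhaseSpace N)}
    (hE : E.IsGeneratedBy σ) : E.IsCovariant := by
  intro x X hX
  have hemb : MeasurableEmbedding fun y : PhaseSpace N => y + x :=
    (Homeomorph.addRight x).measurableEmbedding
  ext1 ψ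
  refine ext_inner_left ℂ fun φ => ?_
  have hx : ∀ χ : ModeSpace N, ⟪φ, weyl x χ⟫_ℂ = ⟪weyl (-x) φ, χ⟫_ℂ := fun χ => by
    rw [inner_weyl_left, neg_neg]
  rw [(hE _ (hemb.measurableSet_image.2 hX) φ ψ).2, adjoint_weyl, mul_apply_eq_comp,
    mul_apply_eq_comp, hx, (hE X hX _ _).2,
    (measurePreserving_add_right volume x).setIntegral_image_emb hemb]
  congr 2
  exact funext fun y => weylKernel_weyl_neg φ ψ x y

/-- The characteristic function of `E_σ`. -/
theorem Observable.IsGeneratedBy.charFun_diagMeasure (hσ : IsState σ)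
    {E : Observable N (PhaseSpace N)} (hE : E.IsGeneratedBy σ) (t : PhaseSpace N)
    (ψ : ModeSpace N) :
    ⟪ψ, (weylTransform σ (phaseRot t) • weyl (-phaseRot t)) ψ⟫_ℂ =
      charFun (E.diagMeasure ψ) t := by
  obtain ⟨S, hSp, hSS⟩ := hσ.isPositive.exists_sqrt
  have hS : ∀ φ ψ, ⟪S φ, S ψ⟫_ℂ = ⟪φ, σ ψ⟫_ℂ := fun φ ψ => by
    rw [hSp.inner_left_eq_inner_right, hSS]
  have hc : (((2 * Real.pi) ^ N : ℝ) : ℂ) ≠ 0 := by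
    exact_mod_cast (pow_pos Real.two_pi_pos N).ne'
  set d : PhaseSpace N → ℝ := fun x => ((2 * Real.pi) ^ N)⁻¹ * ‖S (weyl (-x) ψ)‖ ^ 2
  have hd0 : ∀ x, 0 ≤ d x := fun x => by positivity
  have hkd : ∀ x, (((2 * Real.pi) ^ N : ℝ) : ℂ)⁻¹ * weylKernel σ ψ ψ x = d x := fun x => by
    rw [weylKernel_self hS]
    norm_cast
  have hd : Integrable d := by
    have h := ((hσ.integrable_weylKernel ψ ψ).const_mul (((2 * Real.pi) ^ N : ℝ) : ℂ)⁻¹).re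
    simpa only [hkd, RCLike.re_to_complex, Complex.ofReal_re] using h
  have hdiag : E.diagMeasure ψ = volume.withDensity fun x => ENNReal.ofReal (d x) := by
    ext X hX
    rw [E.diagMeasure_apply ψ hX, withDensity_apply _ hX,
      ← ofReal_integral_eq_lintegral_ofReal hd.integrableOn
        (Filter.Eventually.of_forall hd0), (hE X hX ψ ψ).2, ← integral_const_mul]
    congr 1
    have h : ∫ x in X, (((2 * Real.pi) ^ N : ℝ) : ℂ)⁻¹ * weylKernel σ ψ ψ x =
        ((∫ x in X, d x : ℝ) : ℂ) := by
      simp only [hkd]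
      exact integral_complex_ofReal
    exact (congrArg Complex.re h).trans (Complex.ofReal_re _)
  -- With `u = -J t` one has `symp u x = ⟪t, x⟫`, so the symplectic Fourier transform becomes the
  -- ordinary one.
  have h := hσ.integral_exp_mul_weylKernel ψ ψ (-phaseRot t)
  rw [neg_neg] at h
  rw [hdiag, charFun_withDensity_ofReal hd, smul_apply, inner_smul_right,
    ← inv_mul_cancel_left₀ hc (weylTransform σ (phaseRot t) * _), ← h, ← integral_const_mul]
  refine integral_congr_ae (Filter.Eventually.of_forall fun x => ?_)
  simp only [max_eq_left (hd0 x), ← hkd]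
  rw [← inner_phaseRot_left, map_neg, phaseRot_phaseRot, neg_neg, real_inner_comm,
    mul_comm Complex.I]
  ring

/-- The density criterion with `A = -J`: since `J` is bijective, the reached set is the reflection
of `{σ̂ ≠ 0}`, and reflection preserves density. -/
theorem Observable.IsGeneratedBy.informationallyComplete_iff (hN : 1 ≤ N) (hσ : IsState σ)
    {E : Observable N (PhaseSpace N)} (hE : E.IsGeneratedBy σ) :
    InformationallyComplete (fun _ : Unit => E) ↔ tsupport (weylTransform σ) = Set.univ := by
  rw [informationallyComplete_iff_dense hN (E := fun _ : Unit => E)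
    (A := fun _ t => -phaseRot t) (f := fun _ t => weylTransform σ (phaseRot t))
    (fun _ t => by rw [map_neg]) (fun _ t ψ => hE.charFun_diagMeasure hσ t ψ), tsupport,
    ← dense_iff_closure_eq]
  have hset : (⋃ _ : Unit, {y | ∃ t, weylTransform σ (phaseRot t) ≠ 0 ∧ -phaseRot t = y}) =
      Neg.neg ⁻¹' Function.support (weylTransform σ) := by
    ext y
    simp only [Set.mem_iUnion, Set.mem_ofPred_eq, exists_const, Set.mem_preimage,
      Function.mem_support]
    constructor
    · rintro ⟨t, ht, rfl⟩
      rwa [neg_neg]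
    · intro h
      refine ⟨phaseRot y, ?_, ?_⟩
      · rwa [phaseRot_phaseRot]
      · rw [phaseRot_phaseRot, neg_neg]
  rw [hset]
  have hopen : IsOpenMap (Neg.neg : PhaseSpace N → PhaseSpace N) :=
    (Homeomorph.neg (PhaseSpace N)).isOpenMap
  refine ⟨fun h => ?_, fun h => h.preimage hopen⟩
  simpa [Set.preimage_preimage] using h.preimage hopen

end Covariant

end

theorem mainTheorem8 (N : ℕ) (hN : 1 ≤ N) :
    (∀ (I : Type*) (M : I → ℕ) (E : (j : I) → Observable N (EuclideanSpace ℝ (Fin (M j))))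
      (A₀ : (j : I) → Matrix (Fin N × Fin 2) (Fin (M j)) ℝ)
      (f₀ : (j : I) → EuclideanSpace ℝ (Fin (M j)) → ℂ),
      (∀ j, (E j).IsLinearBosonic (A₀ j) (f₀ j)) →
        (InformationallyComplete E ↔ Dense (⋃ j, reachedSet (A₀ j) (f₀ j)))) ∧
    (∀ σ : ModeSpace N →L[ℂ] ModeSpace N, IsState σ →
      (∃ E : Observable N (PhaseSpace N), E.IsGeneratedBy σ) ∧
      (∀ E : Observable N (PhaseSpace N), E.IsGeneratedBy σ →
        E.IsCovariant ∧
        (InformationallyComplete (fun _ : Unit => E) ↔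
          tsupport (weylTransform σ) = Set.univ))) := by
  refine ⟨fun I M E A₀ f₀ h => ?_, fun σ hσ => ⟨hσ.exists_isGeneratedBy, fun E hE =>
    ⟨hE.isCovariant, hE.informationallyComplete_iff hN hσ⟩⟩⟩
  exact informationallyComplete_iff_dense hN (A := fun j p => (A₀ j).toEuclideanLin p)
    (fun j p => map_neg _ p) fun j p ψ => h j p ψ
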